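/- For a prime $p$ let $\mathrm{UT}(4,p)$ be the group of upper triangular $4\times 4$ matrices over $\mathbb{Z}_p=\mathbb{Z}/p\mathbb{Z}$ with all diagonal entries equal to $1$. The satisfiability problem for spherical equations over the family $(\mathrm{UT}(4,p))_{p\text{ prime}}$ is the following decision problem. Input: a prime $p$, given in binary, and matrices $c_1,\dots,c_k\in \mathrm{UT}(4,p)$ ($k\ge 0$), whose entries are given by their representatives in $\{0,\dots,p-1\}$ in binary. Question: are there $z_1,\dots,z_k\in \mathrm{UT}(4,p)$ with $\prod_{i=1}^k z_i^{-1}c_iz_i=1$ (product taken in this order)? This problem, with both $p$ and $k$ part of the input, is in $\mathsf{P}$: there are a deterministic Turing machine and a polynomial $f$ such that, for every input as above, encoded as a word $w$ over a fixed finite alphabet, the machine started on $w$ halts after at most $f(|w|)$ steps with the correct answer. -/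

import Mathlib

open Computability Turing

/-- `UT(n, R)`: the group of invertible upper triangular `n × n` matrices over `R` whose diagonal
entries are all equal to `1`, as a subgroup of `GL(n, R)`. -/
def unitriangularGroup (n : ℕ) (R : Type) [CommRing R] : Subgroup (GL (Fin n) R) where
  carrier := {A | (∀ i j, j < i → A.1 i j = 0) ∧ ∀ i, A.1 i i = 1}
  one_mem' := ⟨fun i j h => by simp [h.ne'], fun i => by simp⟩
  mul_mem' := by
    rintro A B ⟨hA, hA'⟩ ⟨hB, hB'⟩
    refine ⟨fun i j h => ?_, fun i => ?_⟩
    · simp only [Units.val_mul, Matrix.mul_apply]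
      refine Finset.sum_eq_zero fun k _ => ?_
      rcases lt_or_ge k i with h1 | h1
      · rw [hA _ _ h1, zero_mul]
      · rw [hB _ _ (h.trans_le h1), mul_zero]
    · simp only [Units.val_mul, Matrix.mul_apply]
      rw [Finset.sum_eq_single i, hA', hB', one_mul]
      · intro k _ hk
        rcases lt_or_gt_of_ne hk with h1 | h1
        · rw [hA _ _ h1, zero_mul]
        · rw [hB _ _ h1, mul_zero]
      · simp
  inv_mem' := by
    rintro A ⟨hA, hA'⟩
    have hT : ∀ i j, j < i → (A⁻¹).1 i j = 0 := by
      have h1 : (A.1)⁻¹.BlockTriangular id :=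
        letI : Invertible A.1 := A.invertible
        Matrix.blockTriangular_inv_of_blockTriangular fun i j h => hA i j h
      intro i j h
      rw [Matrix.coe_units_inv]
      exact h1 h
    refine ⟨hT, fun i => ?_⟩
    have h2 : (A.1 * (A⁻¹).1) i i = 1 := by
      rw [← Units.val_mul, mul_inv_cancel]; simp
    rw [Matrix.mul_apply, Finset.sum_eq_single i, hA', one_mul] at h2
    · exact h2
    · intro k _ hk
      rcases lt_or_gt_of_ne hk with h1 | h1
      · rw [hA _ _ h1, zero_mul]
      · rw [hT _ _ h1, mul_zero]
    · simp

/-- The set of tuples `(c₁, …, c_k)` of elements of `G`, `k ∈ ℕ`, for which the spherical equation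
`∏ zᵢ⁻¹ cᵢ zᵢ = 1` (an ordered product) has a solution `(z₁, …, z_k)` in `G`. -/
def SphEq (G : Type) [Group G] : Set (List G) :=
  {c | ∃ z : Fin c.length → G, (List.ofFn fun i => (z i)⁻¹ * c.get i * z i).prod = 1}

/-- A decision problem, given by a type `α` of instances, an encoding of the instances as words
over an alphabet `Γ`, and the set `L` of yes-instances, is in `P` if some deterministic Turing
machine, started on the encoding of any instance `a`, halts after at most polynomially many steps
in the length of the encoding, and outputs whether `a ∈ L`. -/
def InP {α Γ : Type} (e : Encoding α Γ) (L : Set α) : Prop :=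
  open Classical in
  Nonempty (TM2ComputableInPolyTime e.encode encodeBool fun a => decide (a ∈ L))

/-- The instances: a prime `p` and a finite sequence of elements of `UT(4, p)`. -/
abbrev UT4Instance : Type :=
  Σ p : Nat.Primes, List (unitriangularGroup 4 (ZMod p))

/-- The instances `(p, c₁, …, c_k)` with `(c₁, …, c_k) ∈ SphEq (UT(4, p))`. -/
def SphEqUT4 : Set UT4Instance :=
  {I | I.2 ∈ SphEq (unitriangularGroup 4 (ZMod I.1))}

/-- A natural number in binary, closed by a comma. -/
def encodeNumber (n : ℕ) : List Γ' :=
  (encodeNat n).map Γ'.bit ++ [Γ'.comma]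

/-- A matrix: its 16 entries row by row, each entry by its representative in `{0, …, p - 1}` in
binary, in brackets. -/
def encodeUT4 {p : ℕ} (A : unitriangularGroup 4 (ZMod p)) : List Γ' :=
  Γ'.bra :: ((List.finRange 4).flatMap fun i => (List.finRange 4).flatMap fun j =>
    encodeNumber (A.1.1 i j).val) ++ [Γ'.ket]

/-- An instance: `p` in binary, followed by the matrices. -/
def encodeUT4Instance (I : UT4Instance) : List Γ' :=
  encodeNumber I.1 ++ I.2.flatMap encodeUT4

theorem encodeNumber_append_inj {m n : ℕ} {s t : List Γ'}
    (h : encodeNumber m ++ s = encodeNumber n ++ t) : m = n ∧ s = t := by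
  have key : ∀ a b : List Bool, a.map Γ'.bit ++ Γ'.comma :: s = b.map Γ'.bit ++ Γ'.comma :: t →
      a = b ∧ s = t := by
    intro a
    induction a with
    | nil => intro b hb; cases b <;> simp_all
    | cons x a ih =>
      intro b hb
      cases b with
      | nil => simp at hb
      | cons y b =>
        simp only [List.map_cons, List.cons_append, List.cons.injEq, Γ'.bit.injEq] at hb
        obtain ⟨rfl, h2⟩ := ih b hb.2
        exact ⟨by rw [hb.1], h2⟩
  obtain ⟨h1, h2⟩ := key (encodeNat m) (encodeNat n) (by simpa [encodeNumber] using h)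
  exact ⟨by rw [← decode_encodeNat m, h1, decode_encodeNat], h2⟩

theorem encodeUT4_append_inj {p : ℕ} [NeZero p] {A B : unitriangularGroup 4 (ZMod p)}
    {s t : List Γ'} (h : encodeUT4 A ++ s = encodeUT4 B ++ t) : A = B ∧ s = t := by
  have hrow : ∀ (l : List (Fin 4 × Fin 4)) (s t : List Γ'),
      l.flatMap (fun q => encodeNumber (A.1.1 q.1 q.2).val) ++ s =
        l.flatMap (fun q => encodeNumber (B.1.1 q.1 q.2).val) ++ t →
      (∀ q ∈ l, A.1.1 q.1 q.2 = B.1.1 q.1 q.2) ∧ s = t := by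
    intro l
    induction l with
    | nil => intro s t h; simpa using h
    | cons q l ih =>
      intro s t h
      simp only [List.flatMap_cons, List.append_assoc] at h
      obtain ⟨h1, h2⟩ := encodeNumber_append_inj h
      obtain ⟨h3, h4⟩ := ih _ _ h2
      refine ⟨fun r hr => ?_, h4⟩
      rcases List.mem_cons.1 hr with rfl | hr
      · exact ZMod.val_injective p h1
      · exact h3 r hr
  obtain ⟨h1, h2⟩ := hrow
    ((List.finRange 4).flatMap fun i => (List.finRange 4).map fun j => (i, j))
    (Γ'.ket :: s) (Γ'.ket :: t) (by
      simpa [encodeUT4, List.flatMap_assoc, List.flatMap_map] using h)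
  refine ⟨?_, by simpa using h2⟩
  ext i j
  exact h1 (i, j) (by simp)

theorem encodeUT4Instance_injective : Function.Injective encodeUT4Instance := by
  rintro ⟨p, c⟩ ⟨q, d⟩ h
  obtain ⟨h1, h2⟩ := encodeNumber_append_inj h
  obtain rfl : p = q := Subtype.ext h1
  have : NeZero (p : ℕ) := ⟨p.2.ne_zero⟩
  congr 1
  simp only at h2
  clear h h1
  induction c generalizing d with
  | nil => cases d <;> simp_all [encodeUT4]
  | cons A c ih =>
    cases d with
    | nil => simp [encodeUT4] at h2
    | cons B d =>
      simp only [List.flatMap_cons] at h2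
      obtain ⟨rfl, h3⟩ := encodeUT4_append_inj h2
      rw [ih d h3]

/-- The instances as words over the finite alphabet `Γ'`. -/
noncomputable def encodingUT4Instance : Encoding UT4Instance Γ' where
  encode := encodeUT4Instance
  decode := Function.partialInv encodeUT4Instance
  decode_encode := Function.partialInv_left encodeUT4Instance_injective

/-!
The problem reduces to a few additions and multiplications modulo `p` per matrix, for the following
reason. Write `g ∈ UT(4, p)` as a block matrix with diagonal blocks `U(a)`, `U(c)` and upper right
block `M = (d, f; b, e)`, where `U(x)` is the elementary `2 × 2` matrix with upper right entry `x`,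
and attach to it the matrix `M U(-c)`. Then the matrices attached to the conjugates of `g` form the
set `orbit g` of all `U(X) M U(W) + U(a) N - N U(c)`, which is invariant under multiplication by
matrices `U(x)` from both sides. By this invariance the equation with constants `c₁, …, c_k` is
solvable if and only if the entries `a` and the entries `c` sum to zero, and `0` lies in the Minkowski
sum of the sets `orbit cᵢ` (`UT4.mem_sphEq_iff`); the order of the constants does not matter any more.

Suppose that the entries `b` sum to zero, too. If some `(a, c)` is not zero, the Minkowski sum is as
large as it can be, unless all `b` vanish and all `(a, c)` are proportional, in which case there is
one linear condition on the sums of the entries `d` and `e`. If all `(a, c)` are zero, an element with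
`b ≠ 0` contributes the quadruples `(b, D, E, (D E - det M) / b)` with arbitrary `D`, `E`; three of
them have a full Minkowski sum, as have one of them and an element with `b = 0`, `(d, e) ≠ 0`. If
there are exactly two of them and no such element, the products `D E` cancel and one equation remains
(`UT4.zero_mem_sum_orbit_iff_of_ne`, `UT4.zero_mem_sum_orbit_iff_of_eq_zero`,
`UT4.zero_mem_sum_orbit_iff_of_exists`).

The machine is obtained from a program in a small structured language by `StackProg.code`. The bound
`StackProg.cost` on its running time is a polynomial in the number of iterations of the loops
(`StackProg.Runs.steps`), so that it remains to see that no loop is iterated more often than the input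
is long. All numbers are stored on a single stack, whose symbols contain the digits at one position of
the modulus and of all registers; arithmetic modulo `p` is done by letter-to-letter transducers which
sweep over this stack, and multiplication by repeated doubling. The main loop maintains the invariant
`UT4Prog.Inv`, and the final decision is correct by `UT4Prog.Inv.mem_sphEq_iff`.
-/

/-! ### Structured programs on stacks -/

/-- Structured programs acting on a finite control state in `σ` and stacks indexed by `K`, the stack
`k` having alphabet `Γ k`. The loop `loop T c B` executes `T`, and then, if the control state
satisfies `c`, executes `B` and starts over. -/
inductive StackProg {K : Type} (Γ : K → Type) (σ : Type) : Type
  | load (f : σ → σ)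
  | push (k : K) (f : σ → Γ k)
  | pop (k : K) (f : σ → Option (Γ k) → σ)
  | seq (P Q : StackProg Γ σ)
  | ite (c : σ → Bool) (P Q : StackProg Γ σ)
  | loop (T : StackProg Γ σ) (c : σ → Bool) (B : StackProg Γ σ)

/-- `RelIter R k s t`: the state `t` is reached from `s` by `k` successive transitions in `R`. -/
def RelIter {S : Type} (R : S → S → Prop) : ℕ → S → S → Prop
  | 0, s, t => s = t
  | k + 1, s, t => ∃ u, R s u ∧ RelIter R k u t

namespace StackProg

variable {K : Type} {Γ : K → Type} {σ : Type}

/-- A state of a program: the control state and the contents of the stacks. -/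
abbrev State (Γ : K → Type) (σ : Type) : Type := σ × (∀ k, List (Γ k))

/-- `P.Runs n s t`: the program `P` leads from the state `s` to the state `t`, and no loop of `P` is
iterated more than `n` times in a row. -/
def Runs [DecidableEq K] (n : ℕ) : StackProg Γ σ → State Γ σ → State Γ σ → Prop
  | load f, s, t => t = (f s.1, s.2)
  | push k f, s, t => t = (s.1, Function.update s.2 k (f s.1 :: s.2 k))
  | pop k f, s, t => t = (f s.1 (s.2 k).head?, Function.update s.2 k (s.2 k).tail)
  | seq P Q, s, t => ∃ u, Runs n P s u ∧ Runs n Q u t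
  | ite c P Q, s, t => bif c s.1 then Runs n P s t else Runs n Q s t
  | loop T c B, s, t => ∃ k ≤ n, ∃ u,
      RelIter (fun s t => ∃ u, Runs n T s u ∧ c u.1 = true ∧ Runs n B u t) k s u ∧
        Runs n T u t ∧ c t.1 = false

/-- A bound for the running time of a program, as a polynomial in the maximal number of iterations
of its loops. -/
noncomputable def cost : StackProg Γ σ → Polynomial ℕ
  | load _ => 1
  | push _ _ => 1
  | pop _ _ => 1
  | seq P Q => cost P + cost Q
  | ite _ P Q => 1 + cost P + cost Q
  | loop T _ B => (Polynomial.X + 1) * (cost T + cost B + 1)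

/-- The labels of the compiled program. -/
def Label : StackProg Γ σ → Type
  | load _ => Unit
  | push _ _ => Unit
  | pop _ _ => Unit
  | seq P Q => Label P ⊕ Label Q
  | ite _ P Q => Unit ⊕ (Label P ⊕ Label Q)
  | loop T _ B => Unit ⊕ (Label T ⊕ Label B)

/-- The label at which the compiled program starts. -/
def entry : (P : StackProg Γ σ) → P.Label
  | load _ => ()
  | push _ _ => ()
  | pop _ _ => ()
  | seq P _ => Sum.inl (entry P)
  | ite _ _ _ => Sum.inl ()
  | loop T _ _ => Sum.inr (Sum.inl (entry T))

theorem finite_label (P : StackProg Γ σ) : Finite P.Label := by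
  induction P with
  | load _ => exact inferInstanceAs (Finite Unit)
  | push _ _ => exact inferInstanceAs (Finite Unit)
  | pop _ _ => exact inferInstanceAs (Finite Unit)
  | seq P Q _ _ => exact inferInstanceAs (Finite (P.Label ⊕ Q.Label))
  | ite _ P Q _ _ => exact inferInstanceAs (Finite (Unit ⊕ (P.Label ⊕ Q.Label)))
  | loop P _ Q _ _ => exact inferInstanceAs (Finite (Unit ⊕ (P.Label ⊕ Q.Label)))

/-- The statements of the compiled program, placed in a machine with label type `Λ` by means of
`emb`, and followed by the statement `next`. -/
def code {Λ : Type} : (P : StackProg Γ σ) → (P.Label → Λ) → TM2.Stmt Γ Λ σ → P.Label →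
    TM2.Stmt Γ Λ σ
  | load f, _, next, _ => .load f next
  | push k f, _, next, _ => .push k f next
  | pop k f, _, next, _ => .pop k f next
  | seq P Q, emb, next, l => match l with
    | .inl l => code P (fun l => emb (.inl l)) (.goto fun _ => emb (.inr Q.entry)) l
    | .inr l => code Q (fun l => emb (.inr l)) next l
  | ite c P Q, emb, next, l => match l with
    | .inl _ => .branch c (.goto fun _ => emb (.inr (.inl P.entry)))
        (.goto fun _ => emb (.inr (.inr Q.entry)))
    | .inr (.inl l) => code P (fun l => emb (.inr (.inl l))) next l
    | .inr (.inr l) => code Q (fun l => emb (.inr (.inr l))) next l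
  | loop T c B, emb, next, l => match l with
    | .inl _ => .branch c (.goto fun _ => emb (.inr (.inr B.entry))) next
    | .inr (.inl l) => code T (fun l => emb (.inr (.inl l))) (.goto fun _ => emb (.inl ())) l
    | .inr (.inr l) => code B (fun l => emb (.inr (.inr l)))
        (.goto fun _ => emb (.inr (.inl T.entry))) l

variable [DecidableEq K]

/-- `Steps m a b t`: the machine with program `m` passes from `a` to `b` in at most `t` steps. -/
def Steps {Λ : Type} (m : Λ → TM2.Stmt Γ Λ σ) (a b : TM2.Cfg Γ Λ σ) (t : ℕ) : Prop :=
  ∃ n ≤ t, (flip bind (TM2.step m))^[n] (some a) = some b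

theorem Steps.trans {Λ : Type} {m : Λ → TM2.Stmt Γ Λ σ} {a b c : TM2.Cfg Γ Λ σ} {t u : ℕ}
    (h₁ : Steps m a b t) (h₂ : Steps m b c u) : Steps m a c (t + u) := by
  obtain ⟨i, hi, h₁⟩ := h₁
  obtain ⟨j, hj, h₂⟩ := h₂
  exact ⟨j + i, by omega, by rw [Function.iterate_add_apply, h₁, h₂]⟩

theorem Steps.mono {Λ : Type} {m : Λ → TM2.Stmt Γ Λ σ} {a b : TM2.Cfg Γ Λ σ} {t u : ℕ}
    (h : Steps m a b t) (htu : t ≤ u) : Steps m a b u :=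
  h.imp fun _ hi => ⟨hi.1.trans htu, hi.2⟩

theorem Steps.single {Λ : Type} {m : Λ → TM2.Stmt Γ Λ σ} {l : Λ} {q : TM2.Stmt Γ Λ σ}
    (h : m l = q) (v : σ) (S : ∀ k, List (Γ k)) :
    Steps m ⟨some l, v, S⟩ (TM2.stepAux q v S) 1 :=
  ⟨1, le_rfl, h ▸ rfl⟩

/-- The compiled program simulates the structured program, within the time `cost`. -/
theorem Runs.steps {Λ : Type} (m : Λ → TM2.Stmt Γ Λ σ) {n : ℕ} (P : StackProg Γ σ) :
    ∀ {s t : State Γ σ} (emb : P.Label → Λ) (next : TM2.Stmt Γ Λ σ),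
      (∀ l, m (emb l) = P.code emb next l) → P.Runs n s t →
      Steps m ⟨some (emb P.entry), s.1, s.2⟩ (TM2.stepAux next t.1 t.2) (P.cost.eval n) := by
  induction P with
  | load f =>
    rintro s t emb next hm rfl
    exact (Steps.single (hm ()) s.1 s.2).mono (by simp [cost])
  | push k f =>
    rintro s t emb next hm rfl
    exact (Steps.single (hm ()) s.1 s.2).mono (by simp [cost])
  | pop k f =>
    rintro s t emb next hm rfl
    exact (Steps.single (hm ()) s.1 s.2).mono (by simp [cost])
  | seq P Q ihP ihQ =>
    rintro s t emb next hm ⟨u, h₁, h₂⟩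
    have e₁ := ihP (fun l => emb (.inl l)) _ (fun l => hm (.inl l)) h₁
    have e₂ := ihQ (fun l => emb (.inr l)) _ (fun l => hm (.inr l)) h₂
    exact (e₁.trans e₂).mono (by simp [cost])
  | ite c P Q ihP ihQ =>
    rintro s t emb next hm h
    have e₀ := Steps.single (hm (.inl ())) s.1 s.2
    simp only [code, TM2.stepAux] at e₀
    simp only [Runs] at h
    cases hc : c s.1 with
    | true =>
      rw [hc] at h e₀
      have e₁ := ihP (fun l => emb (.inr (.inl l))) _ (fun l => hm (.inr (.inl l))) h
      refine (e₀.trans e₁).mono ?_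
      simp [cost]
    | false =>
      rw [hc] at h e₀
      have e₁ := ihQ (fun l => emb (.inr (.inr l))) _ (fun l => hm (.inr (.inr l))) h
      refine (e₀.trans e₁).mono ?_
      simp only [cost, Polynomial.eval_add, Polynomial.eval_one]
      omega
  | loop T c B ihT ihB =>
    rintro s t emb next hm ⟨k, hk, u, h₁, h₂, h₃⟩
    have eT : ∀ {s t}, T.Runs n s t → Steps m ⟨some (emb (entry (loop T c B))), s.1, s.2⟩
        ⟨some (emb (.inl ())), t.1, t.2⟩ (T.cost.eval n) := fun h =>
      ihT (fun l => emb (.inr (.inl l))) _ (fun l => hm (.inr (.inl l))) h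
    have eB : ∀ {s t}, B.Runs n s t → Steps m ⟨some (emb (.inr (.inr B.entry))), s.1, s.2⟩
        ⟨some (emb (entry (loop T c B))), t.1, t.2⟩ (B.cost.eval n) := fun h =>
      ihB (fun l => emb (.inr (.inr l))) _ (fun l => hm (.inr (.inr l))) h
    have eI : Steps m ⟨some (emb (entry (loop T c B))), s.1, s.2⟩
        ⟨some (emb (entry (loop T c B))), u.1, u.2⟩
        (k * (T.cost.eval n + B.cost.eval n + 1)) := by
      clear hk h₂
      induction k generalizing s with
      | zero => obtain rfl := h₁; exact ⟨0, by simp, rfl⟩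
      | succ k ih =>
        obtain ⟨w, ⟨v, hT, hc, hB⟩, hw⟩ := h₁
        have e₀ := Steps.single (hm (.inl ())) v.1 v.2
        simp only [code, TM2.stepAux, hc, cond_true] at e₀
        refine ((((eT hT).trans e₀).trans (eB hB)).trans (ih hw)).mono (le_of_eq ?_)
        ring
    have e₀ := Steps.single (hm (.inl ())) t.1 t.2
    simp only [code, TM2.stepAux, h₃, cond_false] at e₀
    refine (eI.trans ((eT h₂).trans e₀)).mono ?_
    simp only [cost, Polynomial.eval_add, Polynomial.eval_mul, Polynomial.eval_one,
      Polynomial.eval_X]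
    nlinarith [Nat.mul_le_mul_right (T.cost.eval n + B.cost.eval n + 1) hk]

end StackProg

/-! ### Binary numbers -/

/-- The number with the given binary digits, the least significant one first. -/
def bitVal : List Bool → ℕ
  | [] => 0
  | b :: l => b.toNat + 2 * bitVal l

theorem bitVal_lt (l : List Bool) : bitVal l < 2 ^ l.length := by
  induction l with
  | nil => simp [bitVal]
  | cons b l ih =>
    have := b.toNat_le
    simp only [bitVal, List.length_cons, pow_succ]
    omega

theorem bitVal_eq_zero_iff (l : List Bool) : bitVal l = 0 ↔ l.any id = false := by
  induction l with
  | nil => simp [bitVal]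
  | cons b l ih => cases b <;> simp [bitVal, ih]

theorem bitVal_inj {l m : List Bool} (h : l.length = m.length) : bitVal l = bitVal m ↔ l = m := by
  induction l generalizing m with
  | nil => simp [List.length_eq_zero_iff.1 h.symm]
  | cons b l ih =>
    cases m with
    | nil => simp at h
    | cons c m =>
      have := b.toNat_le
      have := c.toNat_le
      rw [List.cons.injEq, ← ih (by simpa using h)]
      simp only [bitVal]
      constructor
      · intro h
        refine ⟨?_, by omega⟩
        have : b.toNat = c.toNat := by omega
        cases b <;> cases c <;> simp_all
      · rintro ⟨rfl, h'⟩
        rw [h']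

theorem bitVal_encodePosNum (n : PosNum) : bitVal (encodePosNum n) = n := by
  induction n with
  | one => rfl
  | bit0 n ih =>
    simp only [encodePosNum, bitVal, ih, PosNum.cast_bit0, Bool.toNat_false]
    omega
  | bit1 n ih =>
    simp only [encodePosNum, bitVal, ih, PosNum.cast_bit1, Bool.toNat_true]
    omega

theorem bitVal_encodeNat (n : ℕ) : bitVal (encodeNat n) = n := by
  conv_rhs => rw [← Num.to_of_nat n]
  unfold encodeNat
  rcases (n : Num) with - | m
  · rfl
  · exact bitVal_encodePosNum m

theorem two_pow_length_encodePosNum_le (n : PosNum) : 2 ^ (encodePosNum n).length ≤ 2 * (n : ℕ) := by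
  induction n with
  | one => simp [encodePosNum]
  | bit0 n ih =>
    simp only [encodePosNum, List.length_cons, PosNum.cast_bit0, pow_succ]
    omega
  | bit1 n ih =>
    simp only [encodePosNum, List.length_cons, PosNum.cast_bit1, pow_succ]
    omega

/-- The encoding has no leading zeros, so that the length is bounded by the size of the number. -/
theorem length_encodeNat_le {n k : ℕ} (h : n < 2 ^ k) : (encodeNat n).length ≤ k := by
  rw [← Num.to_of_nat n] at h
  unfold encodeNat
  revert h
  rcases (n : Num) with - | m
  · intro _
    exact Nat.zero_le _
  · intro h
    have h1 : 2 ^ (encodePosNum m).length < 2 ^ (k + 1) := by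
      have := two_pow_length_encodePosNum_le m
      have h' : (m : ℕ) < 2 ^ k := h
      rw [pow_succ]
      omega
    have := (Nat.pow_lt_pow_iff_right one_lt_two).1 h1
    exact Nat.lt_succ_iff.1 this

/-! ### Letter-to-letter transducers -/

/-- Run a transducer with transition function `f`, started in the state `q`, on a word. The result
is the final state and the word of outputs. -/
def transduce {Q A B : Type} (f : Q → A → Q × B) : Q → List A → Q × List B
  | q, [] => (q, [])
  | q, a :: l => ((transduce f (f q a).1 l).1, (f q a).2 :: (transduce f (f q a).1 l).2)

theorem transduce_append {Q A B : Type} (f : Q → A → Q × B) (q : Q) (l m : List A) :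
    transduce f q (l ++ m) = ((transduce f (transduce f q l).1 m).1,
      (transduce f q l).2 ++ (transduce f (transduce f q l).1 m).2) := by
  induction l generalizing q with
  | nil => rfl
  | cons a l ih => simp [transduce, ih]

theorem transduce_const {Q A B : Type} (h : Q → A → B) (q : Q) (l : List A) :
    transduce (fun q a => (q, h q a)) q l = (q, l.map (h q)) := by
  induction l with
  | nil => rfl
  | cons a l ih => simp [transduce, ih]

theorem length_transduce {Q A B : Type} (f : Q → A → Q × B) (q : Q) (l : List A) :
    (transduce f q l).2.length = l.length := by
  induction l generalizing q with
  | nil => rfl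
  | cons a l ih => simp [transduce, ih]

/-! ### The memory of the machine -/

/-- The stacks: the input, the working stack, an auxiliary stack onto which the working stack is
unloaded, and the output. -/
inductive Stack
  | inp
  | work
  | aux
  | out
  deriving DecidableEq

instance : Fintype Stack :=
  ⟨{Stack.inp, Stack.work, Stack.aux, Stack.out}, by rintro (_ | _ | _ | _) <;> simp⟩

/-- A symbol of the working stack: the binary digits, at one position, of the modulus and of all
registers. -/
abbrev Column (R : Type) : Type := Bool × (R → Bool)

/-- The alphabets of the stacks. A symbol on the auxiliary stack carries two additional bits. -/
def Stack.Alphabet (R : Type) : Stack → Type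
  | inp => Γ'
  | work => Column R
  | aux => Column R × Bool × Bool
  | out => Bool

/-- The control state: two bits of memory, and the symbols read last from the stacks. -/
structure Control (R : Type) where
  /-- Two bits of memory. -/
  q : Bool × Bool
  /-- The symbol read last from the working stack. -/
  w : Option (Column R)
  /-- The symbol read last from the auxiliary stack. -/
  x : Option (Column R × Bool × Bool)
  /-- The symbol read last from the input. -/
  ch : Option Γ'

noncomputable instance {R : Type} [Finite R] : Fintype (Control R) := by
  classical
  have := Fintype.ofFinite R
  exact Fintype.ofInjective (fun c : Control R => (c.q, c.w, c.x, c.ch)) (by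
    rintro ⟨⟩ ⟨⟩ h
    simpa using h)

section

variable {R : Type}

/-- The contents of the stacks. -/
def memory (i : List Γ') (W : List (Column R)) (X : List (Column R × Bool × Bool)) (o : List Bool) :
    ∀ k : Stack, List (k.Alphabet R)
  | .inp => i
  | .work => W
  | .aux => X
  | .out => o

section

variable (i i' : List Γ') (W W' : List (Column R)) (X X' : List (Column R × Bool × Bool)) (o o' : List Bool)

theorem update_memory_inp :
    Function.update (memory i W X o) .inp i' = memory i' W X o := by
  funext k; cases k <;> rfl

theorem update_memory_work :
    Function.update (memory i W X o) .work W' = memory i W' X o := by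
  funext k; cases k <;> rfl

theorem update_memory_aux :
    Function.update (memory i W X o) .aux X' = memory i W X' o := by
  funext k; cases k <;> rfl

theorem update_memory_out :
    Function.update (memory i W X o) .out o' = memory i W X o' := by
  funext k; cases k <;> rfl

end

/-- Programs for the machine with set of registers `R`. -/
abbrev Prog (R : Type) : Type := StackProg (Stack.Alphabet R) (Control R)

/-! ### Sweeps over the memory -/

namespace Prog

open StackProg

/-- Read a symbol from the input. -/
def readCh : Prog R := pop Stack.inp fun c o => { c with ch := o }

/-- Read a symbol from the working stack. -/
def readWork : Prog R := pop Stack.work fun c o => { c with w := o }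

/-- Read a symbol from the auxiliary stack. -/
def readAux : Prog R := pop Stack.aux fun c o => { c with x := o }

/-- The symbol read last from the working stack. -/
def workSym (c : Control R) : Column R := c.w.getD (false, fun _ => false)

/-- The symbol read last from the auxiliary stack. -/
def auxSym (c : Control R) : Column R × Bool × Bool := c.x.getD ((false, fun _ => false), false, false)

/-- Unload the working stack onto the auxiliary stack, applying a transducer. The least significant
digits are read first. -/
def forward (f : Bool × Bool → Column R → (Bool × Bool) × (Column R × Bool × Bool)) : Prog R :=
  loop readWork (fun c => c.w.isSome)
    (seq (push Stack.aux fun c => (f c.q (workSym c)).2)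
      (load fun c => { c with q := (f c.q (workSym c)).1 }))

/-- Unload the auxiliary stack onto the working stack, applying a transducer. The most significant
digits are read first. -/
def backward (g : Bool × Bool → Column R × Bool × Bool → (Bool × Bool) × Column R) : Prog R :=
  loop readAux (fun c => c.x.isSome)
    (seq (push Stack.work fun c => (g c.q (auxSym c)).2)
      (load fun c => { c with q := (g c.q (auxSym c)).1 }))

/-- Two sweeps over the memory, starting with the memory bits `q`. -/
def sweep (q : Bool × Bool) (f : Bool × Bool → Column R → (Bool × Bool) × (Column R × Bool × Bool))
    (g : Bool × Bool → Column R × Bool × Bool → (Bool × Bool) × Column R) : Prog R :=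
  seq (load fun c => { c with q := q }) (seq (forward f) (backward g))

variable {n : ℕ}

section

variable (c : Control R) (i : List Γ') (W : List (Column R)) (X : List (Column R × Bool × Bool))
  (o : List Bool)

theorem runs_readCh : readCh.Runs n (c, memory i W X o)
    ({ c with ch := i.head? }, memory i.tail W X o) :=
  Prod.ext rfl (update_memory_inp ..).symm

theorem runs_readWork : readWork.Runs n (c, memory i W X o)
    ({ c with w := W.head? }, memory i W.tail X o) :=
  Prod.ext rfl (update_memory_work ..).symm

theorem runs_readAux : readAux.Runs n (c, memory i W X o)
    ({ c with x := X.head? }, memory i W X.tail o) :=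
  Prod.ext rfl (update_memory_aux ..).symm

theorem runs_pushWork (f : Control R → Column R) :
    StackProg.Runs (Γ := Stack.Alphabet R) n (push Stack.work f) (c, memory i W X o)
      (c, memory i (f c :: W) X o) :=
  Prod.ext rfl (update_memory_work ..).symm

theorem runs_pushAux (f : Control R → Column R × Bool × Bool) :
    StackProg.Runs (Γ := Stack.Alphabet R) n (push Stack.aux f) (c, memory i W X o)
      (c, memory i W (f c :: X) o) :=
  Prod.ext rfl (update_memory_aux ..).symm

theorem runs_pushOut (f : Control R → Bool) :
    StackProg.Runs (Γ := Stack.Alphabet R) n (push Stack.out f) (c, memory i W X o)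
      (c, memory i W X (f c :: o)) :=
  Prod.ext rfl (update_memory_out ..).symm

end

theorem runs_forward (f : Bool × Bool → Column R → (Bool × Bool) × (Column R × Bool × Bool))
    (c : Control R) (i : List Γ') {W : List (Column R)} (X : List (Column R × Bool × Bool))
    (o : List Bool) (hW : W.length ≤ n) :
    ∃ c' : Control R, c'.q = (transduce f c.q W).1 ∧
      (forward f).Runs n (c, memory i W X o)
        (c', memory i [] ((transduce f c.q W).2.reverse ++ X) o) := by
  suffices h : ∃ c' : Control R, c'.q = (transduce f c.q W).1 ∧
      RelIter (fun s t => ∃ u, readWork.Runs n s u ∧ u.1.w.isSome = true ∧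
        (seq (push Stack.aux fun c => (f c.q (workSym c)).2)
          (load fun c => { c with q := (f c.q (workSym c)).1 })).Runs n u t) W.length
        (c, memory i W X o) (c', memory i [] ((transduce f c.q W).2.reverse ++ X) o) by
    obtain ⟨c', h₁, h₂⟩ := h
    exact ⟨{ c' with w := none }, h₁, W.length, hW, _, h₂, runs_readWork .., rfl⟩
  clear hW
  induction W generalizing c X with
  | nil => exact ⟨c, rfl, rfl⟩
  | cons a W ih =>
    obtain ⟨c', h₁, h₂⟩ := ih { c with w := some a, q := (f c.q a).1 } ((f c.q a).2 :: X)
    refine ⟨c', h₁, _, ⟨_, runs_readWork .., rfl, _, runs_pushAux .., rfl⟩, ?_⟩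
    simpa [transduce, workSym] using h₂

theorem runs_backward (g : Bool × Bool → Column R × Bool × Bool → (Bool × Bool) × Column R)
    (c : Control R) (i : List Γ') (W : List (Column R)) {X : List (Column R × Bool × Bool)}
    (o : List Bool) (hX : X.length ≤ n) :
    ∃ c' : Control R, c'.q = (transduce g c.q X).1 ∧
      (backward g).Runs n (c, memory i W X o)
        (c', memory i ((transduce g c.q X).2.reverse ++ W) [] o) := by
  suffices h : ∃ c' : Control R, c'.q = (transduce g c.q X).1 ∧
      RelIter (fun s t => ∃ u, readAux.Runs n s u ∧ u.1.x.isSome = true ∧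
        (seq (push Stack.work fun c => (g c.q (auxSym c)).2)
          (load fun c => { c with q := (g c.q (auxSym c)).1 })).Runs n u t) X.length
        (c, memory i W X o) (c', memory i ((transduce g c.q X).2.reverse ++ W) [] o) by
    obtain ⟨c', h₁, h₂⟩ := h
    exact ⟨{ c' with x := none }, h₁, X.length, hX, _, h₂, runs_readAux .., rfl⟩
  clear hX
  induction X generalizing c W with
  | nil => exact ⟨c, rfl, rfl⟩
  | cons a X ih =>
    obtain ⟨c', h₁, h₂⟩ := ih { c with x := some a, q := (g c.q a).1 } ((g c.q a).2 :: W)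
    refine ⟨c', h₁, _, ⟨_, runs_readAux .., rfl, _, runs_pushWork .., rfl⟩, ?_⟩
    simpa [transduce, auxSym] using h₂

theorem runs_sweep (q : Bool × Bool)
    (f : Bool × Bool → Column R → (Bool × Bool) × (Column R × Bool × Bool))
    (g : Bool × Bool → Column R × Bool × Bool → (Bool × Bool) × Column R)
    (c : Control R) (i : List Γ') {W : List (Column R)} (o : List Bool) (hW : W.length ≤ n)
    {a : (Bool × Bool) × List (Column R × Bool × Bool)} (ha : transduce f q W = a)
    {b : (Bool × Bool) × List (Column R)} (hb : transduce g a.1 a.2.reverse = b) :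
    ∃ c' : Control R, c'.q = b.1 ∧
      (sweep q f g).Runs n (c, memory i W [] o) (c', memory i b.2.reverse [] o) := by
  subst ha hb
  obtain ⟨c₁, h₁, h₂⟩ := runs_forward f { c with q := q } i [] o hW
  obtain ⟨c₂, h₃, h₄⟩ := runs_backward g c₁ i [] (X := (transduce f q W).2.reverse) o
    (n := n) (by simpa [length_transduce] using hW)
  rw [h₁] at h₃ h₄
  exact ⟨c₂, h₃, _, rfl, _, h₂, by simpa using h₄⟩

end Prog

/-! ### Registers with values modulo `p` -/

/-- The words on the working stack represent the modulus `p` and the values `v` of the registers.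
There is room for the sum of two numbers below `p`. -/
structure Holds (p : ℕ) (W : List (Column R)) (v : R → ZMod p) : Prop where
  modulus : bitVal (W.map Prod.fst) = p
  reg : ∀ r, bitVal (W.map fun a => a.2 r) = (v r).val
  width : 2 * p ≤ 2 ^ W.length

namespace Prog

open StackProg Function

variable {p n : ℕ}

/-- `ExecTest n P s b t`: in a state where `s.1` is the rest of the input and the registers have the
values `s.2`, the program `P` leads to a state described by `t` in the same way, in which the first
memory bit is `b`. -/
def ExecTest (n : ℕ) (P : Prog R) (s : List Γ' × (R → ZMod p)) (b : Bool)
    (t : List Γ' × (R → ZMod p)) : Prop :=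
  ∀ (c : Control R) (W : List (Column R)), Holds p W s.2 → W.length ≤ n →
    ∃ (c' : Control R) (W' : List (Column R)), c'.q.1 = b ∧ W'.length = W.length ∧
      Holds p W' t.2 ∧ P.Runs n (c, memory s.1 W [] []) (c', memory t.1 W' [] [])

/-- As `ExecTest`, with no information on the memory bit. -/
def Exec (n : ℕ) (P : Prog R) (s t : List Γ' × (R → ZMod p)) : Prop :=
  ∀ (c : Control R) (W : List (Column R)), Holds p W s.2 → W.length ≤ n →
    ∃ (c' : Control R) (W' : List (Column R)), W'.length = W.length ∧
      Holds p W' t.2 ∧ P.Runs n (c, memory s.1 W [] []) (c', memory t.1 W' [] [])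

/-- The program `P` leaves the input alone and changes the values of the registers by `f`. -/
def Does (n : ℕ) (P : Prog R) (f : (R → ZMod p) → R → ZMod p) : Prop :=
  ∀ i v, Exec n P (i, v) (i, f v)

/-- The program `P` changes neither the input nor the registers, and the first memory bit tells
afterwards whether the values of the registers satisfy `φ`. -/
def Tests (n : ℕ) (P : Prog R) (φ : (R → ZMod p) → Prop) : Prop :=
  ∀ i v b, (b = true ↔ φ v) → ExecTest n P (i, v) b (i, v)

variable {P Q T : Prog R} {s t u : List Γ' × (R → ZMod p)} {b : Bool}

theorem Exec.seq (h₁ : Exec n P s t) (h₂ : Exec n Q t u) : Exec n (.seq P Q) s u := by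
  intro c W hW hn
  obtain ⟨c', W', hl, hW', hP⟩ := h₁ c W hW hn
  obtain ⟨c'', W'', hl', hW'', hQ⟩ := h₂ c' W' hW' (hl.trans_le hn)
  exact ⟨c'', W'', hl'.trans hl, hW'', _, hP, hQ⟩

theorem Does.seq {f g : (R → ZMod p) → R → ZMod p} (h₁ : Does n P f) (h₂ : Does n Q g) :
    Does n (.seq P Q) (fun v => g (f v)) :=
  fun i v => (h₁ i v).seq (h₂ i (f v))

/-- Execute `P` or `Q`, depending on the outcome of the test `T`. -/
def cond (T P Q : Prog R) : Prog R := .seq T (.ite (fun c => c.q.1) P Q)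

/-- Execute `P` as long as the test `T` has a positive outcome. -/
def repeatWhile (T P : Prog R) : Prog R := .loop T (fun c => c.q.1) P

/-- Do nothing. -/
def skip : Prog R := .load id

theorem does_skip : Does (p := p) n (skip : Prog R) id := fun _ _ c W hW _ =>
  ⟨c, W, rfl, hW, rfl⟩

open Classical in
theorem Tests.does_cond {φ : (R → ZMod p) → Prop} {f g : (R → ZMod p) → R → ZMod p} (hT : Tests n T φ)
    (hP : Does n P f) (hQ : Does n Q g) :
    Does n (cond T P Q) (fun v => if φ v then f v else g v) := by
  intro i v c W hW hn
  obtain ⟨c', W', hb, hl, hW', hT⟩ := hT i v (decide (φ v)) (by simp) c W hW hn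
  by_cases h : φ v
  · obtain ⟨c'', W'', hl', hW'', hP⟩ := hP i v c' W' hW' (hl.trans_le hn)
    exact ⟨c'', W'', hl'.trans hl, by simpa [h] using hW'', _, hT, by
      simpa [Runs, hb, h] using hP⟩
  · obtain ⟨c'', W'', hl', hW'', hQ⟩ := hQ i v c' W' hW' (hl.trans_le hn)
    exact ⟨c'', W'', hl'.trans hl, by simpa [h] using hW'', _, hT, by
      simpa [Runs, hb, h] using hQ⟩

/-- A loop, given the states at the beginnings of its `k` iterations. -/
theorem Exec.repeatWhile {k : ℕ} (hk : k ≤ n)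
    (h : RelIter (fun s t => ∃ u, ExecTest n T s true u ∧ Exec n P u t) k s t)
    (hT : ExecTest n T t false u) : Exec n (Prog.repeatWhile T P) s u := by
  intro c W hW hn
  suffices H : ∃ (c' : Control R) (W' : List (Column R)), W'.length = W.length ∧
      Holds p W' t.2 ∧ RelIter (fun s t => ∃ u, T.Runs n s u ∧ u.1.q.1 = true ∧ P.Runs n u t) k
        (c, memory s.1 W [] []) (c', memory t.1 W' [] []) by
    obtain ⟨c', W', hl, hW', hr⟩ := H
    obtain ⟨c'', W'', hb, hl', hW'', hT⟩ := hT c' W' hW' (hl.trans_le hn)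
    exact ⟨c'', W'', hl'.trans hl, hW'', k, hk, _, hr, hT, hb⟩
  clear hk
  induction k generalizing c W s with
  | zero => obtain rfl := h; exact ⟨c, W, rfl, hW, rfl⟩
  | succ k ih =>
    obtain ⟨w, ⟨x, hTx, hPx⟩, hr⟩ := h
    obtain ⟨c₁, W₁, hb, hl₁, hW₁, h₁⟩ := hTx c W hW hn
    obtain ⟨c₂, W₂, hl₂, hW₂, h₂⟩ := hPx c₁ W₁ hW₁ (hl₁.trans_le hn)
    obtain ⟨c₃, W₃, hl₃, hW₃, h₃⟩ := ih hr c₂ W₂ hW₂ ((hl₂.trans hl₁).trans_le hn)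
    exact ⟨c₃, W₃, hl₃.trans (hl₂.trans hl₁), hW₃, _, ⟨_, h₁, hb, h₂⟩, h₃⟩

/-! ### Elementary operations on registers -/

/-- Apply `h` to every symbol on the working stack. -/
def mapSym (h : Column R → Column R) : Prog R :=
  sweep (false, false) (fun q a => (q, h a, false, false)) (fun q a => (q, a.1))

theorem runs_mapSym (h : Column R → Column R) (c : Control R) (i : List Γ') {W : List (Column R)}
    (o : List Bool) (hW : W.length ≤ n) : ∃ c' : Control R,
      (mapSym h).Runs n (c, memory i W [] o) (c', memory i (W.map h) [] o) := by
  obtain ⟨c', -, h'⟩ := runs_sweep (false, false) (fun q a => (q, h a, false, false))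
    (fun q a => (q, a.1)) c i o hW (transduce_const ..) (transduce_const ..)
  refine ⟨c', ?_⟩
  simpa [Function.comp_def, mapSym] using h'

/-- Test whether some symbol on the working stack satisfies `h`. -/
def anySym (h : Column R → Bool) : Prog R :=
  sweep (false, false) (fun q a => ((q.1 || h a, q.2), a, false, false)) (fun q a => (q, a.1))

theorem runs_anySym (h : Column R → Bool) (c : Control R) (i : List Γ') {W : List (Column R)}
    (o : List Bool) (hW : W.length ≤ n) : ∃ c' : Control R, c'.q.1 = W.any h ∧
      (anySym h).Runs n (c, memory i W [] o) (c', memory i W [] o) := by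
  have key : ∀ (q : Bool × Bool) (W : List (Column R)),
      transduce (fun q a => ((q.1 || h a, q.2), a, false, false)) q W =
        ((q.1 || W.any h, q.2), W.map fun a => (a, false, false)) := by
    intro q W
    induction W generalizing q with
    | nil => simp [transduce]
    | cons a W ih => simp [transduce, ih, Bool.or_assoc]
  obtain ⟨c', h₁, h'⟩ := runs_sweep (false, false)
    (fun q a => ((q.1 || h a, q.2), a, false, false))
    (fun q a => (q, a.1)) c i o hW (key ..) (transduce_const ..)
  refine ⟨c', by simp [h₁], ?_⟩
  simpa [Function.comp_def, anySym] using h'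

theorem Tests.anySym {h : Column R → Bool} {φ : (R → ZMod p) → Prop}
    (hφ : ∀ W v, Holds p W v → (W.any h = true ↔ φ v)) : Tests n (anySym h) φ := by
  intro i v b hb c W hW hn
  obtain ⟨c', h₁, h₂⟩ := runs_anySym h c i [] hn
  exact ⟨c', W, by rw [h₁, Bool.eq_iff_iff, hφ W v hW, hb], rfl, hW, h₂⟩

/-- Test whether the register `r` is nonzero. -/
def isNonzero (r : R) : Prog R := anySym fun a => a.2 r

theorem tests_isNonzero (r : R) : Tests (p := p) n (isNonzero r) (fun v => v r ≠ 0) := by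
  refine Tests.anySym fun W v hW => ?_
  have h₁ := bitVal_eq_zero_iff (W.map fun a => a.2 r)
  rw [hW.reg, ZMod.val_eq_zero, List.any_map] at h₁
  simp only [ne_eq, h₁, Function.comp_def, id, Bool.not_eq_false]

/-- Test whether the registers `r` and `s` are different. -/
def areDistinct (r s : R) : Prog R := anySym fun a => a.2 r ^^ a.2 s

theorem tests_areDistinct [NeZero p] (r s : R) :
    Tests (p := p) n (areDistinct r s) (fun v => v r ≠ v s) := by
  refine Tests.anySym fun W v hW => ?_
  have h₁ := bitVal_inj (l := W.map fun a => a.2 r) (m := W.map fun a => a.2 s) (by simp)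
  rw [hW.reg, hW.reg, (ZMod.val_injective p).eq_iff, List.map_inj_left] at h₁
  simp only [ne_eq, h₁, List.any_eq_true, bne_iff_ne, not_forall, exists_prop]

variable [DecidableEq R]

/-- Change the bit of the register `r`. -/
def setBit (r : R) (b : Bool) (a : Column R) : Column R := (a.1, update a.2 r b)

@[simp] theorem setBit_fst (r : R) (b : Bool) (a : Column R) : (setBit r b a).1 = a.1 := rfl

theorem setBit_snd (r s : R) (b : Bool) (a : Column R) :
    (setBit r b a).2 s = if s = r then b else a.2 s := by
  simp [setBit, update_apply]

/-- Criterion for changing the value of the register `r`. -/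
theorem Holds.update {W W' : List (Column R)} {v : R → ZMod p} (h : Holds p W v) (r : R)
    {x : ZMod p} (hm : W'.map Prod.fst = W.map Prod.fst)
    (hs : ∀ s ≠ r, (W'.map fun a => a.2 s) = W.map fun a => a.2 s)
    (hr : bitVal (W'.map fun a => a.2 r) = x.val) : Holds p W' (update v r x) where
  modulus := by rw [hm, h.modulus]
  reg s := by
    rcases eq_or_ne s r with rfl | hsr
    · rw [hr, update_self]
    · rw [hs s hsr, h.reg, update_of_ne hsr]
  width := by
    have := congrArg List.length hm
    simp only [List.length_map] at this
    rw [this]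
    exact h.width

/-- Set the register `r` to zero. -/
def clear (r : R) : Prog R := mapSym (setBit r false)

theorem does_clear [NeZero p] (r : R) : Does (p := p) n (clear r) (fun v => update v r 0) := by
  intro i v c W hW hn
  obtain ⟨c', h⟩ := runs_mapSym (setBit r false) c i [] hn
  refine ⟨c', _, by simp, Holds.update hW r (by simp) ?_ ?_, h⟩
  · intro s hs
    simp [setBit_snd, hs]
  · rw [ZMod.val_zero, bitVal_eq_zero_iff]
    simp [setBit_snd]

/-- Copy the register `s` to the register `r`. -/
def copy (r s : R) : Prog R := mapSym fun a => setBit r (a.2 s) a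

theorem does_copy (r s : R) : Does (p := p) n (copy r s) (fun v => update v r (v s)) := by
  intro i v c W hW hn
  obtain ⟨c', h⟩ := runs_mapSym (fun a => setBit r (a.2 s) a) c i [] hn
  refine ⟨c', _, by simp, Holds.update hW r (by simp) ?_ ?_, h⟩
  · intro s hs
    simp [setBit_snd, hs]
  · rw [← hW.reg]
    simp [setBit_snd, Function.comp_def]

/-! ### Halving -/

/-- Test whether the number in the register `r` is odd. -/
def isOdd (r : R) : Prog R :=
  sweep (false, false) (fun q a => (q, a, false, false)) (fun q a => ((a.1.2 r, q.2), a.1))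

omit [DecidableEq R] in
/-- The digit seen last in the sweep back is the least significant one. -/
theorem tests_isOdd (r : R) : Tests (p := p) n (isOdd r) (fun v => (v r).val % 2 = 1) := by
  intro i v b hb c W hW hn
  have key : ∀ (q : Bool × Bool) (W : List (Column R)),
      transduce (fun q (a : Column R × Bool × Bool) => ((a.1.2 r, q.2), a.1)) q
        (W.map fun a => (a, false, false)).reverse =
        (((W.map fun a => a.2 r).headD q.1, q.2), W.reverse) := by
    intro q W
    induction W with
    | nil => simp [transduce]
    | cons a W ih => simp [transduce, transduce_append, ih]
  obtain ⟨c', h₁, h'⟩ := runs_sweep (false, false) (fun q a => (q, a, false, false))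
    (fun q a => ((a.1.2 r, q.2), a.1)) c i [] hn (transduce_const ..) (key ..)
  refine ⟨c', W, ?_, rfl, hW, by simpa [isOdd] using h'⟩
  rw [h₁, Bool.eq_iff_iff, hb]
  simp only [← hW.reg]
  cases W with
  | nil => simp [bitVal]
  | cons a W => cases h : a.2 r <;> simp [bitVal, h]

/-- Halve the number in the register `r`, rounding down. -/
def half (r : R) : Prog R :=
  sweep (false, false) (fun q a => (q, a, false, false))
    (fun q a => ((a.1.2 r, q.2), setBit r q.1 a.1))

/-- The sweep back starts at the most significant digits, so that each digit of `r` can be replaced by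
the one seen just before. -/
theorem does_half [NeZero p] (r : R) :
    Does (p := p) n (half r) (fun v => update v r (((v r).val / 2 : ℕ) : ZMod p)) := by
  intro i v c W hW hn
  have key : ∀ W : List (Column R), ∃ W' : List (Column R),
      transduce (fun q (a : Column R × Bool × Bool) => ((a.1.2 r, q.2), setBit r q.1 a.1))
        (false, false) (W.map fun a => (a, false, false)).reverse =
        (((W.map fun a => a.2 r).headD false, false), W'.reverse) ∧
      W'.map Prod.fst = W.map Prod.fst ∧
      (∀ s ≠ r, (W'.map fun a => a.2 s) = W.map fun a => a.2 s) ∧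
      bitVal (W'.map fun a => a.2 r) = bitVal (W.map fun a => a.2 r) / 2 := by
    intro W
    induction W with
    | nil => exact ⟨[], by simp [transduce, bitVal]⟩
    | cons a W ih =>
      obtain ⟨W', h₁, h₂, h₃, h₄⟩ := ih
      refine ⟨setBit r ((W.map fun a => a.2 r).headD false) a :: W', ?_, ?_, ?_, ?_⟩
      · simp [transduce, transduce_append, h₁]
      · simp [h₂]
      · intro s hs
        simp [setBit_snd, hs, h₃ s hs]
      · simp only [List.map_cons, setBit_snd, if_true, bitVal, h₄]
        have hh : (List.headD (W.map fun a => a.2 r) false).toNat =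
            bitVal (W.map fun a => a.2 r) % 2 := by
          cases W with
          | nil => simp [bitVal]
          | cons a W => cases h : a.2 r <;> simp [bitVal, h]
        rw [hh]
        have := (a.2 r).toNat_le
        omega
  obtain ⟨W', h₁, h₂, h₃, h₄⟩ := key W
  obtain ⟨c', -, h'⟩ := runs_sweep (false, false) (fun q a => (q, a, false, false))
    (fun q a => ((a.1.2 r, q.2), setBit r q.1 a.1)) c i [] hn (transduce_const ..) h₁
  refine ⟨c', W', ?_, Holds.update hW r h₂ h₃ ?_, by simpa [half] using h'⟩
  · simpa using congrArg List.length h₂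
  · rw [h₄, hW.reg, ZMod.val_natCast_of_lt]
    exact (Nat.div_le_self _ _).trans_lt (ZMod.val_lt _)

/-! ### Addition -/

/-- One step of the simultaneous computation of the digits of `r + s` and of `r + s - p`; the state
consists of the carry of the addition and the borrow of the subtraction. -/
def addStep (r s : R) (q : Bool × Bool) (a : Column R) :
    (Bool × Bool) × (Column R × Bool × Bool) :=
  let d := a.2 r ^^ a.2 s ^^ q.1
  (((a.2 r && a.2 s) || (q.1 && (a.2 r || a.2 s)),
    (!d && (a.1 || q.2)) || (a.1 && q.2)), a, d, d ^^ a.1 ^^ q.2)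

/-- Add the register `s` to the register `r`, modulo `p`. If the final borrow shows that `r + s < p`,
the digits of `r + s` are written to `r`, and otherwise those of `r + s - p`. -/
def add (r s : R) : Prog R :=
  sweep (false, false) (addStep r s)
    (fun q a => (q, setBit r (bif q.2 then a.2.1 else a.2.2) a.1))

omit [DecidableEq R] in
theorem addStep_spec (r s : R) (q : Bool × Bool) (a : Column R) :
    (addStep r s q a).2.2.1.toNat + 2 * (addStep r s q a).1.1.toNat =
      (a.2 r).toNat + (a.2 s).toNat + q.1.toNat ∧
    (addStep r s q a).2.2.1.toNat + 2 * (addStep r s q a).1.2.toNat =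
      (addStep r s q a).2.2.2.toNat + a.1.toNat + q.2.toNat := by
  obtain ⟨c, d⟩ := q
  obtain ⟨m, f⟩ := a
  simp only [addStep]
  generalize f r = x
  generalize f s = y
  revert c d m x y
  decide

omit [DecidableEq R] in
/-- The first sweep of the addition: up to the final carry and the final borrow, which have the weight
`2 ^ W.length`, the two additional bits contain the digits of `r + s` and of `r + s - p`. -/
theorem transduce_addStep (r s : R) (q : Bool × Bool) (W : List (Column R)) :
    ((transduce (addStep r s) q W).2.map Prod.fst = W) ∧
    bitVal ((transduce (addStep r s) q W).2.map fun a => a.2.1) +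
        2 ^ W.length * (transduce (addStep r s) q W).1.1.toNat =
      bitVal (W.map fun a => a.2 r) + bitVal (W.map fun a => a.2 s) + q.1.toNat ∧
    bitVal ((transduce (addStep r s) q W).2.map fun a => a.2.1) +
        2 ^ W.length * (transduce (addStep r s) q W).1.2.toNat =
      bitVal ((transduce (addStep r s) q W).2.map fun a => a.2.2) + bitVal (W.map Prod.fst) +
        q.2.toNat := by
  induction W generalizing q with
  | nil => simp [transduce, bitVal]
  | cons a W ih =>
    obtain ⟨h₁, h₂, h₃⟩ := ih (addStep r s q a).1
    obtain ⟨e₁, e₂⟩ := addStep_spec r s q a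
    refine ⟨by simpa [transduce] using ⟨rfl, h₁⟩, ?_, ?_⟩
    · simp only [transduce, List.map_cons, bitVal, List.length_cons, pow_succ, mul_right_comm _ 2]
      omega
    · simp only [transduce, List.map_cons, bitVal, List.length_cons, pow_succ, mul_right_comm _ 2]
      omega

theorem does_add [NeZero p] (r s : R) :
    Does (p := p) n (add r s) (fun v => update v r (v r + v s)) := by
  intro i v c W hW hn
  obtain ⟨h₁, h₂, h₃⟩ := transduce_addStep r s (false, false) W
  obtain ⟨c', -, h'⟩ := runs_sweep (false, false) (addStep r s)
    (fun q a => (q, setBit r (bif q.2 then a.2.1 else a.2.2) a.1)) c i [] hn rfl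
    (transduce_const ..)
  rw [List.map_reverse, List.reverse_reverse] at h'
  set A := transduce (addStep r s) (false, false) W with hA
  have h₁' : ∀ {B : Type} (f : Column R → B), A.2.map (fun a => f a.1) = W.map f := by
    intro B f
    rw [← h₁, List.map_map]
    rfl
  refine ⟨c', _, ?_, Holds.update hW r ?_ ?_ ?_, h'⟩
  · simp [hA, length_transduce]
  · rw [List.map_map]
    exact h₁' Prod.fst
  · intro t ht
    rw [List.map_map]
    simpa [Function.comp_def, setBit_snd, ht] using h₁' fun a => a.2 t
  · rw [List.map_map]
    simp only [Function.comp_def, setBit_snd, if_true]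
    rw [hW.reg, hW.reg, Bool.toNat_false] at h₂
    rw [hW.modulus, Bool.toNat_false] at h₃
    have hr := ZMod.val_lt (v r)
    have hs := ZMod.val_lt (v s)
    have hw := hW.width
    dsimp only at h₂
    have hS := bitVal_lt (A.2.map fun a => a.2.1)
    have hD := bitVal_lt (A.2.map fun a => a.2.2)
    rw [List.length_map, hA, length_transduce, ← hA] at hS hD
    -- There is no final carry, since `r + s < 2 * p ≤ 2 ^ W.length`.
    have hc : A.1.1 = false := by
      by_contra hc
      rw [Bool.not_eq_false] at hc
      rw [hc, Bool.toNat_true] at h₂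
      omega
    rw [hc, Bool.toNat_false] at h₂
    rw [ZMod.val_add]
    cases hb : A.1.2 with
    | true =>
      rw [hb, Bool.toNat_true] at h₃
      simp only [cond_true]
      rw [Nat.mod_eq_of_lt] <;> omega
    | false =>
      rw [hb, Bool.toNat_false] at h₃
      simp only [cond_false]
      rw [Nat.mod_eq_sub_mod, Nat.mod_eq_of_lt] <;> omega

end Prog

/-! ### Reading numbers -/

namespace Prog

open StackProg Function

variable {p n : ℕ}

theorem bitVal_append_replicate (l : List Bool) (k : ℕ) :
    bitVal (l ++ List.replicate k false) = bitVal l := by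
  induction l with
  | nil => simp [bitVal_eq_zero_iff, bitVal]
  | cons b l ih => simp [bitVal, ih]

/-- Whether the symbol read last from the input is a digit. -/
def isBit (c : Control R) : Bool :=
  match c.ch with
  | some (Γ'.bit _) => true
  | _ => false

/-- The digit read last from the input. -/
def bitOf (c : Control R) : Bool :=
  match c.ch with
  | some (Γ'.bit b) => b
  | _ => false

/-- Read the modulus. All registers are set to zero. One position more than there are digits is
allocated. -/
def readModulus : Prog R :=
  seq (loop readCh isBit (push Stack.aux fun c => ((bitOf c, fun _ => false), false, false)))
    (seq (push Stack.aux fun _ => ((false, fun _ => false), false, false))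
      (backward fun q a => (q, a.1)))

theorem runs_readModulus [NeZero p] (c : Control R) (i : List Γ')
    (hn : (encodeNat p).length + 1 ≤ n) :
    ∃ (c' : Control R) (W : List (Column R)), W.length ≤ n ∧ Holds (R := R) p W 0 ∧
      readModulus.Runs n (c, memory (encodeNumber p ++ i) [] [] []) (c', memory i W [] []) := by
  have key : ∀ (l : List Bool) (c : Control R) (X : List (Column R × Bool × Bool)),
      ∃ c' : Control R, RelIter (fun s t => ∃ u, readCh.Runs n s u ∧ isBit u.1 = true ∧
        StackProg.Runs (Γ := Stack.Alphabet R) n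
          (push Stack.aux fun c => ((bitOf c, fun _ => false), false, false)) u t) l.length
        (c, memory (l.map Γ'.bit ++ Γ'.comma :: i) [] X [])
        (c', memory (Γ'.comma :: i) []
          ((l.map fun b => ((b, fun _ => false), false, false)).reverse ++ X) []) := by
    intro l
    induction l with
    | nil => exact fun c X => ⟨c, rfl⟩
    | cons b l ih =>
      intro c X
      obtain ⟨c', h⟩ := ih { c with ch := some (Γ'.bit b) }
        (((b, fun _ => false), false, false) :: X)
      refine ⟨c', _, ⟨_, runs_readCh .., rfl, runs_pushAux ..⟩, ?_⟩
      simpa [bitOf] using h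
  obtain ⟨c', h⟩ := key (encodeNat p) c []
  set X : List (Column R × Bool × Bool) := ((false, fun _ => false), false, false) ::
    ((encodeNat p).map fun b => ((b, fun _ => false), false, false)).reverse with hX
  obtain ⟨c'', -, h'⟩ := runs_backward (n := n) (fun q a => (q, a.1))
    { c' with ch := some Γ'.comma } i [] (X := X) [] (by simpa [hX] using hn)
  refine ⟨c'', _, ?_, ?_, _, ⟨(encodeNat p).length, by omega, _, ?_,
    runs_readCh c' (Γ'.comma :: i) [] _ [], rfl⟩, _, runs_pushAux .., h'⟩
  · simpa [transduce_const, hX] using hn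
  · rw [transduce_const]
    have e : bitVal (encodeNat p ++ [false]) = p := by
      rw [← List.replicate_one, bitVal_append_replicate, bitVal_encodeNat]
    refine ⟨?_, fun r => ?_, ?_⟩
    · simpa [hX, Function.comp_def] using e
    · simp [hX, Function.comp_def, bitVal_eq_zero_iff]
    · have := bitVal_lt (encodeNat p)
      rw [bitVal_encodeNat] at this
      simp only [hX, List.append_nil, List.length_reverse, List.length_map, List.length_cons,
        pow_succ]
      omega
  · simpa [encodeNumber] using h

variable [DecidableEq R]

/-- Read a number below the modulus from the input into the register `r`. -/
def readNum (r : R) : Prog R :=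
  seq (loop readCh isBit
      (seq readWork (push Stack.aux fun c => (setBit r (bitOf c) (workSym c), false, false))))
    (seq (forward fun q a => (q, setBit r false a, false, false)) (backward fun q a => (q, a.1)))

theorem exec_readNum (r : R) {m : ℕ} (hm : m < p) (i : List Γ') (v : R → ZMod p) :
    Exec n (readNum r) (encodeNumber m ++ i, v) (i, update v r (m : ZMod p)) := by
  intro c W hW hn
  -- The loop replaces the digits at the positions present in the input.
  have key : ∀ (l : List Bool) (c : Control R) (W : List (Column R))
      (X : List (Column R × Bool × Bool)), l.length ≤ W.length →
      ∃ c' : Control R, RelIter (fun s t => ∃ u, readCh.Runs n s u ∧ isBit u.1 = true ∧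
        (seq readWork (push Stack.aux fun c =>
          (setBit r (bitOf c) (workSym c), false, false))).Runs n u t) l.length
        (c, memory (l.map Γ'.bit ++ Γ'.comma :: i) W X [])
        (c', memory (Γ'.comma :: i) (W.drop l.length)
          ((List.zipWith (fun b a => (setBit r b a, false, false)) l W).reverse ++ X) []) := by
    intro l
    induction l with
    | nil => exact fun c W X _ => ⟨c, by simp [RelIter]⟩
    | cons b l ih =>
      intro c W X hl
      cases W with
      | nil => simp at hl
      | cons a W =>
        obtain ⟨c', h⟩ := ih { c with ch := some (Γ'.bit b), w := some a } W
          ((setBit r b a, false, false) :: X) (by simpa using hl)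
        refine ⟨c', _, ⟨_, runs_readCh .., rfl, _, runs_readWork .., runs_pushAux ..⟩, ?_⟩
        simpa [bitOf, workSym] using h
  have hl : (encodeNat m).length ≤ W.length := by
    have := hW.width
    exact length_encodeNat_le (by omega)
  obtain ⟨c₁, h₁⟩ := key (encodeNat m) c W [] hl
  obtain ⟨c₂, -, h₂⟩ := runs_forward (n := n) (fun q a => (q, setBit r false a, false, false))
    { c₁ with ch := some Γ'.comma } i (W := W.drop (encodeNat m).length)
    ((List.zipWith (fun b a => (setBit r b a, false, false)) (encodeNat m) W).reverse ++ []) []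
    (by simp; omega)
  obtain ⟨c₃, -, h₃⟩ := runs_backward (n := n) (fun q a => (q, a.1)) c₂ i []
    (X := (transduce (fun q a => (q, setBit r false a, false, false)) c₁.q
      (W.drop (encodeNat m).length)).2.reverse ++
      ((List.zipWith (fun b a => (setBit r b a, false, false)) (encodeNat m) W).reverse ++ [])) []
    (by simp [transduce_const]; omega)
  refine ⟨c₃, _, ?_, ?_, _, ⟨(encodeNat m).length, hl.trans hn, _, ?_,
    runs_readCh c₁ (Γ'.comma :: i) _ _ [], rfl⟩, _, h₂, h₃⟩
  · simp [transduce_const, hl]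
  · simp only [transduce_const, List.append_nil, List.map_append, List.map_reverse,
      List.reverse_append, List.reverse_reverse, List.map_map, Function.comp_def, List.map_zipWith]
    have e₁ : ∀ (l : List Bool) (W : List (Column R)), l.length ≤ W.length →
        ∀ {B : Type} (f : Column R → B), (∀ a b, f (setBit r b a) = f a) →
        (List.zipWith (fun b a => setBit r b a) l W ++ (W.drop l.length).map (setBit r false)).map f
          = W.map f := by
      intro l
      induction l with
      | nil => intro W _ B f hf; simp [hf]
      | cons b l ih =>
        intro W hl B f hf
        cases W with
        | nil => simp at hl
        | cons a W =>
          simp only [List.zipWith_cons_cons, List.length_cons, List.drop_succ_cons,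
            List.cons_append, List.map_cons, hf, ih W (by simpa using hl) f hf]
    have e₂ : ∀ (l : List Bool) (W : List (Column R)), l.length ≤ W.length →
        (List.zipWith (fun b a => setBit r b a) l W ++ (W.drop l.length).map (setBit r false)).map
          (fun a => a.2 r) = l ++ List.replicate (W.length - l.length) false := by
      intro l
      induction l with
      | nil => intro W _; simp [setBit_snd, Function.comp_def]
      | cons b l ih =>
        intro W hl
        cases W with
        | nil => simp at hl
        | cons a W =>
          simp only [List.zipWith_cons_cons, List.length_cons, List.drop_succ_cons,
            List.cons_append, List.map_cons, ih W (by simpa using hl), Nat.add_sub_add_right]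
          simp [setBit_snd]
    refine Holds.update hW r (e₁ _ W hl _ fun _ _ => rfl)
      (fun s hs => e₁ _ W hl _ fun _ _ => by simp [setBit_snd, hs]) ?_
    rw [e₂ _ W hl, bitVal_append_replicate, bitVal_encodeNat, ZMod.val_natCast_of_lt hm]
  · simpa [encodeNumber] using h₁

/-! ### Multiplication -/

/-- Set the register `d` to the product of the registers `a` and `b`, with `x` and `y` as auxiliary
registers, by repeated doubling of `x` and halving of `y`. -/
def mul (x y d a b : R) : Prog R :=
  seq (seq (copy x a) (seq (copy y b) (clear d)))
    (seq (repeatWhile (isNonzero y)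
      (seq (cond (isOdd y) (add d x) skip) (seq (add x x) (half y))))
      (clear x))

theorem does_mul [NeZero p] {x y d a b : R} (hxy : x ≠ y) (hdx : d ≠ x) (hdy : d ≠ y)
    (hbx : b ≠ x) : Does (p := p) n (mul x y d a b)
      (fun v => update (update (update v x 0) y 0) d (v a * v b)) := by
  intro i v
  have hB := ((tests_isOdd (p := p) (n := n) y).does_cond (does_add d x) does_skip).seq
    ((does_add x x).seq (does_half y))
  have hI := (does_copy (p := p) (n := n) x a).seq ((does_copy y b).seq (does_clear d))
  -- The loop keeps `d + x * y` constant, and ends with `y = 0`.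
  have key : ∀ (k : ℕ) (v : R → ZMod p), (v y).val < 2 ^ k → ∃ j ≤ k, ∃ v' : R → ZMod p,
      RelIter (fun s t => ∃ u, ExecTest n (isNonzero y) s true u ∧
        Exec n (seq (cond (isOdd y) (add d x) skip) (seq (add x x) (half y))) u t) j
        (i, v) (i, v') ∧ v' y = 0 ∧ v' d = v d + v x * v y ∧
        ∀ r, r ≠ x → r ≠ y → r ≠ d → v' r = v r := by
    intro k
    induction k with
    | zero =>
      intro v hv
      have h0 : v y = 0 := by
        rw [← ZMod.val_eq_zero]
        simpa using hv
      exact ⟨0, le_rfl, v, rfl, h0, by simp [h0], fun _ _ _ _ => rfl⟩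
    | succ k ih =>
      intro v hv
      by_cases h0 : v y = 0
      · exact ⟨0, Nat.zero_le _, v, rfl, h0, by simp [h0], fun _ _ _ _ => rfl⟩
      · have h₁ := hB i v
        revert h₁
        generalize hw : (fun v : R → ZMod p => _) v = w
        intro h₁
        have wy : w y = ((v y).val / 2 : ℕ) := by
          rw [← hw]
          split_ifs <;> simp [hdy.symm, hxy.symm]
        have wx : w x = v x + v x := by
          rw [← hw]
          split_ifs <;> simp [hdx.symm, hxy]
        have wd : w d = v d + v x * ((v y).val % 2 : ℕ) := by
          rw [← hw]
          split_ifs with h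
          · simp [hdx, hdy, h]
          · simp [hdx, hdy, Nat.mod_two_ne_one.1 h]
        have wr : ∀ r, r ≠ x → r ≠ y → r ≠ d → w r = v r := by
          intro r hx hy hd
          rw [← hw]
          split_ifs <;> simp [hx, hy, hd]
        have hlt : (w y).val < 2 ^ k := by
          rw [wy, ZMod.val_natCast_of_lt ((Nat.div_le_self _ _).trans_lt (ZMod.val_lt _))]
          rw [pow_succ] at hv
          omega
        obtain ⟨j, hj, v', hr, h₂, h₃, h₄⟩ := ih w hlt
        refine ⟨j + 1, by omega, v', ⟨_, ⟨_, tests_isNonzero y i v true (by simpa using h0), h₁⟩, hr⟩,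
          h₂, ?_, fun r hx hy hd => (h₄ r hx hy hd).trans (wr r hx hy hd)⟩
        have e : v y = 2 * ((v y).val / 2 : ℕ) + ((v y).val % 2 : ℕ) := by
          conv_lhs => rw [← ZMod.natCast_zmod_val (v y), ← Nat.div_add_mod (v y).val 2]
          push_cast
          ring
        rw [h₃, wd, wx, wy]
        conv_rhs => rw [e]
        ring
  intro c W hW hn
  have hk : ∀ v : R → ZMod p, (v y).val < 2 ^ n := fun v => by
    have h₁ := ZMod.val_lt (v y)
    have h₂ := hW.width
    have h₃ : 2 ^ W.length ≤ 2 ^ n := Nat.pow_le_pow_right two_pos hn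
    omega
  obtain ⟨j, hj, v', hr, h₁, h₂, h₃⟩ := key n _ (hk (update (update (update v x (v a)) y
    (update v x (v a) b)) d 0))
  have h := (hI i v).seq ((Exec.repeatWhile hj hr
    (tests_isNonzero y i v' false (by simpa using h₁))).seq (does_clear x i v'))
  have e : update v' x 0 = update (update (update v x 0) y 0) d (v a * v b) := by
    funext r
    by_cases hd : r = d
    · subst hd
      simp [hdx, h₂, hbx, hdx.symm, hdy.symm, hxy]
    · by_cases hx : r = x
      · subst hx
        simp [hd, hxy]
      · by_cases hy : r = y
        · subst hy
          simp [hd, hx, h₁]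
        · simp [hd, hx, hy, h₃ r hx hy hd]
  simp only [← e]
  exact h c W hW hn

/-! ### Decisions -/

omit [DecidableEq R] in
open Classical in
/-- The program `P` writes on the output whether the values of the registers satisfy `φ`. -/
def Decides (n : ℕ) (P : Prog R) (φ : (R → ZMod p) → Prop) : Prop :=
  ∀ (i : List Γ') (v : R → ZMod p) (c : Control R) (W : List (Column R)), Holds p W v →
    W.length ≤ n → ∃ (c' : Control R) (W' : List (Column R)), W'.length ≤ n ∧
      P.Runs n (c, memory i W [] []) (c', memory i W' [] [decide (φ v)])

omit [DecidableEq R] in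
theorem Decides.congr {P : Prog R} {φ ψ : (R → ZMod p) → Prop} (h : Decides n P φ)
    (hφ : ∀ v, φ v ↔ ψ v) : Decides n P ψ := by
  rwa [← funext fun v => propext (hφ v)]

omit [DecidableEq R] in
theorem decides_push (b : Bool) (P : Prop) (h : b = true ↔ P) :
    Decides (R := R) (p := p) n (push Stack.out fun _ => b) (fun _ => P) := by
  classical
  intro i v c W hW hn
  refine ⟨c, W, hn, ?_⟩
  have : decide P = b := by rw [Bool.eq_iff_iff, h, decide_eq_true_iff]
  rw [this]
  exact runs_pushOut ..

/-- Answer positively. -/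
def accept : Prog R := push Stack.out fun _ => true

/-- Answer negatively. -/
def reject : Prog R := push Stack.out fun _ => false

omit [DecidableEq R] in
theorem decides_accept : Decides (R := R) (p := p) n accept (fun _ => True) :=
  decides_push _ _ (by simp)

omit [DecidableEq R] in
theorem decides_reject : Decides (R := R) (p := p) n reject (fun _ => False) :=
  decides_push _ _ (by simp)

omit [DecidableEq R] in
theorem Tests.decides_cond {T P Q : Prog R} {φ ψ χ : (R → ZMod p) → Prop} (hT : Tests n T φ)
    (hP : Decides n P ψ) (hQ : Decides n Q χ) :
    Decides n (cond T P Q) (fun v => (φ v ∧ ψ v) ∨ (¬φ v ∧ χ v)) := by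
  classical
  intro i v c W hW hn
  obtain ⟨c', W', hb, hl, hW', hT⟩ := hT i v (decide (φ v)) (by simp) c W hW hn
  by_cases h : φ v
  · obtain ⟨c'', W'', hl', hP⟩ := hP i v c' W' hW' (hl.trans_le hn)
    exact ⟨c'', W'', hl', _, hT, by simpa [Runs, hb, h] using hP⟩
  · obtain ⟨c'', W'', hl', hQ⟩ := hQ i v c' W' hW' (hl.trans_le hn)
    exact ⟨c'', W'', hl', _, hT, by simpa [Runs, hb, h] using hQ⟩

omit [DecidableEq R] in
theorem Does.decides {P Q : Prog R} {f : (R → ZMod p) → R → ZMod p} {φ : (R → ZMod p) → Prop}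
    (hP : Does n P f) (hQ : Decides n Q φ) : Decides n (StackProg.seq P Q) (fun v => φ (f v)) := by
  intro i v c W hW hn
  obtain ⟨c', W', hl, hW', hP⟩ := hP i v c W hW hn
  obtain ⟨c'', W'', hl', hQ⟩ := hQ i (f v) c' W' hW' (hl.trans_le hn)
  exact ⟨c'', W'', hl', _, hP, hQ⟩

end Prog

end

/-! ### Coordinates on `UT(4, F)` -/

namespace UT4

open scoped Pointwise

variable {F : Type} [Field F]

/-- The group `UT(4, F)`. -/
abbrev UT (F : Type) [Field F] : Type := unitriangularGroup 4 F

/-- The entry in position `(0, 1)`. -/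
def a (g : UT F) : F := g.1.1 0 1
/-- The entry in position `(1, 2)`. -/
def b (g : UT F) : F := g.1.1 1 2
/-- The entry in position `(2, 3)`. -/
def c (g : UT F) : F := g.1.1 2 3
/-- The entry in position `(0, 2)`. -/
def d (g : UT F) : F := g.1.1 0 2
/-- The entry in position `(1, 3)`. -/
def e (g : UT F) : F := g.1.1 1 3
/-- The entry in position `(0, 3)`. -/
def f (g : UT F) : F := g.1.1 0 3

theorem val_eq (g : UT F) :
    g.1.1 = !![1, a g, d g, f g; 0, 1, b g, e g; 0, 0, 1, c g; 0, 0, 0, 1] := by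
  have h₀ := g.2.1
  have h₁ := g.2.2
  ext i j
  fin_cases i <;> fin_cases j <;> first | exact h₁ _ | exact h₀ _ _ (by decide) | rfl

theorem val_mul (g h : UT F) : (g * h).1.1 =
    !![1, a g, d g, f g; 0, 1, b g, e g; 0, 0, 1, c g; 0, 0, 0, 1] *
      !![1, a h, d h, f h; 0, 1, b h, e h; 0, 0, 1, c h; 0, 0, 0, 1] := by
  rw [← val_eq g, ← val_eq h]
  rfl

variable (g h : UT F)

theorem a_mul : a (g * h) = a g + a h := by
  refine (congrFun (congrFun (val_mul g h) 0) 1).trans ?_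
  simp [Matrix.mul_apply, Fin.sum_univ_four]
  try ring

theorem b_mul : b (g * h) = b g + b h := by
  refine (congrFun (congrFun (val_mul g h) 1) 2).trans ?_
  simp [Matrix.mul_apply, Fin.sum_univ_four]
  try ring

theorem c_mul : c (g * h) = c g + c h := by
  refine (congrFun (congrFun (val_mul g h) 2) 3).trans ?_
  simp [Matrix.mul_apply, Fin.sum_univ_four]
  try ring

theorem d_mul : d (g * h) = d g + d h + a g * b h := by
  refine (congrFun (congrFun (val_mul g h) 0) 2).trans ?_
  simp [Matrix.mul_apply, Fin.sum_univ_four]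
  try ring

theorem e_mul : e (g * h) = e g + e h + b g * c h := by
  refine (congrFun (congrFun (val_mul g h) 1) 3).trans ?_
  simp [Matrix.mul_apply, Fin.sum_univ_four]
  try ring

theorem f_mul : f (g * h) = f g + f h + a g * e h + d g * c h := by
  refine (congrFun (congrFun (val_mul g h) 0) 3).trans ?_
  simp [Matrix.mul_apply, Fin.sum_univ_four]
  try ring

variable {g h} in
theorem ext_coord (ha : a g = a h) (hb : b g = b h) (hc : c g = c h) (hd : d g = d h)
    (he : e g = e h) (hf : f g = f h) : g = h := by
  apply Subtype.ext
  apply Units.ext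
  rw [val_eq g, val_eq h, ha, hb, hc, hd, he, hf]

theorem exists_coord (a' b' c' d' e' f' : F) :
    ∃ g : UT F, a g = a' ∧ b g = b' ∧ c g = c' ∧ d g = d' ∧ e g = e' ∧ f g = f' := by
  let A : Matrix (Fin 4) (Fin 4) F := !![1, a', d', f'; 0, 1, b', e'; 0, 0, 1, c'; 0, 0, 0, 1]
  have hA : A.det = 1 := by
    simp [A, Matrix.det_succ_row_zero, Fin.sum_univ_succ]
  refine ⟨⟨Matrix.GeneralLinearGroup.mk'' A (by simp [hA]), fun i j hij => ?_, fun i => ?_⟩,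
    rfl, rfl, rfl, rfl, rfl, rfl⟩
  · fin_cases i <;> fin_cases j <;> first | rfl | (exact absurd hij (by decide))
  · fin_cases i <;> rfl

theorem coord_one : a (1 : UT F) = 0 ∧ b (1 : UT F) = 0 ∧ c (1 : UT F) = 0 ∧ d (1 : UT F) = 0 ∧
    e (1 : UT F) = 0 ∧ f (1 : UT F) = 0 := by
  refine ⟨?_, ?_, ?_, ?_, ?_, ?_⟩ <;> simp [a, b, c, d, e, f]

/-! ### Products of conjugates as Minkowski sums -/

/-- The coordinates of `M U(-c)`, where `g` is written as a block matrix with diagonal blocks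
`U(a)`, `U(c)` and upper right block `M`, and `U(x)` stands for the elementary `2 × 2` matrix with
upper right entry `x`. -/
def twist : F × F × F × F := (b g, d g, e g - c g * b g, f g - c g * d g)

/-- The map `N ↦ U(x) N U(-y)` on `2 × 2` matrices. -/
def shift (x y : F) (t : F × F × F × F) : F × F × F × F :=
  (t.1, t.2.1 + x * t.1, t.2.2.1 - y * t.1, t.2.2.2 + x * t.2.2.1 - y * t.2.1 - x * y * t.1)

theorem twist_mul : twist (g * h) = twist g + shift (a g) (c g) (twist h) := by
  ext <;> simp only [twist, shift, b_mul, c_mul, d_mul, e_mul, f_mul, Prod.fst_add, Prod.snd_add]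
    <;> ring

theorem shift_add (x y : F) (s t : F × F × F × F) :
    shift x y (s + t) = shift x y s + shift x y t := by
  ext <;> simp only [shift, Prod.fst_add, Prod.snd_add] <;> ring

theorem shift_neg_shift (x y : F) (t : F × F × F × F) : shift (-x) (-y) (shift x y t) = t := by
  ext <;> simp only [shift] <;> ring

/-- The set of all `U(X) M U(W) + U(a) N - N U(c)`, where `M` is the upper right block of `g` and
`N` is an arbitrary `2 × 2` matrix. These are the twists of the conjugates of `g`. -/
def orbit : Set (F × F × F × F) :=
  {t | t.1 = b g ∧ ∃ X W s m n : F, t.2.1 = d g + X * b g + a g * s ∧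
    t.2.2.1 = e g + W * b g - c g * s ∧
    t.2.2.2 = f g + X * e g + W * d g + X * W * b g + (a g * n - c g * m)}

variable {g} in
theorem shift_mem_orbit (x y : F) {t : F × F × F × F} (ht : t ∈ orbit g) :
    shift x y t ∈ orbit g := by
  obtain ⟨h₁, X, W, s, m, n, h₂, h₃, h₄⟩ := ht
  refine ⟨h₁, X + x, W - y, s, m + x * s, n - y * s, ?_, ?_, ?_⟩ <;>
    simp only [shift, h₁, h₂, h₃, h₄] <;> ring

theorem shift_mem_sum_orbit (x y : F) (l : List (UT F)) {t : F × F × F × F}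
    (ht : t ∈ (l.map orbit).sum) : shift x y t ∈ (l.map orbit).sum := by
  induction l generalizing t with
  | nil =>
    rw [List.map_nil, List.sum_nil, Set.mem_zero] at ht ⊢
    subst ht
    ext <;> simp [shift]
  | cons g l ih =>
    rw [List.map_cons, List.sum_cons] at ht ⊢
    obtain ⟨u, hu, v, hv, rfl⟩ := Set.mem_add.1 ht
    rw [shift_add]
    exact Set.add_mem_add (shift_mem_orbit x y hu) (ih hv)

theorem conj_coord (z : UT F) : a (z⁻¹ * g * z) = a g ∧ c (z⁻¹ * g * z) = c g ∧
    b (z⁻¹ * g * z) = b g ∧ d (z⁻¹ * g * z) = d g + a g * b z - a z * b g ∧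
    e (z⁻¹ * g * z) = e g + b g * c z - b z * c g ∧
    f (z⁻¹ * g * z) = f g + a g * e z + d g * c z - a z * (e g + b g * c z - b z * c g)
      - d z * c g := by
  generalize hk : z⁻¹ * g * z = k
  have hz : z * k = g * z := by rw [← hk]; group
  have ha : a k = a g := by
    have := congrArg a hz
    rw [a_mul, a_mul] at this
    linear_combination this
  have hb : b k = b g := by
    have := congrArg b hz
    rw [b_mul, b_mul] at this
    linear_combination this
  have hc : c k = c g := by
    have := congrArg c hz
    rw [c_mul, c_mul] at this
    linear_combination this
  have hd : d k = d g + a g * b z - a z * b g := by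
    have := congrArg d hz
    rw [d_mul, d_mul, hb] at this
    linear_combination this
  have he : e k = e g + b g * c z - b z * c g := by
    have := congrArg e hz
    rw [e_mul, e_mul, hc] at this
    linear_combination this
  have hf := congrArg f hz
  rw [f_mul, f_mul, he, hc] at hf
  exact ⟨ha, hc, hb, hd, he, by linear_combination hf⟩

theorem mem_orbit_iff (t : F × F × F × F) : t ∈ orbit g ↔ ∃ z : UT F, twist (z⁻¹ * g * z) = t := by
  constructor
  · rintro ⟨h₁, X, W, s, m, n, h₂, h₃, h₄⟩
    obtain ⟨z, hz₁, hz₂, hz₃, hz₄, hz₅, -⟩ :=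
      exists_coord (-X) s (W + c g) (m - X * s) (n + c g * s) 0
    obtain ⟨-, ec, eb, ed, ee, ef⟩ := conj_coord g z
    refine ⟨z, ?_⟩
    ext <;> simp only [twist, ec, eb, ed, ee, ef, hz₁, hz₂, hz₃, hz₄, hz₅, h₁, h₂, h₃, h₄] <;> ring
  · rintro ⟨z, rfl⟩
    obtain ⟨-, ec, eb, ed, ee, ef⟩ := conj_coord g z
    refine ⟨eb, -a z, c z - c g, b z, d z - a z * b z, e z - c g * b z, ?_, ?_, ?_⟩ <;>
      simp only [twist, ec, eb, ed, ee, ef] <;> ring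

/-- The products of conjugates of the elements of `l` are the elements with the right entries `a` and
`c` whose twist lies in the Minkowski sum of the orbits. By `twist_mul`, the twists of the factors are
not just added, but also shifted; this does not matter, as the orbits are invariant under shifts. -/
theorem exists_conj_prod_iff (l : List (UT F)) (g : UT F) :
    (∃ l' : List (UT F), List.Forall₂ (fun x y => ∃ z, y = z⁻¹ * x * z) l l' ∧ l'.prod = g) ↔
      a g = (l.map a).sum ∧ c g = (l.map c).sum ∧ twist g ∈ (l.map orbit).sum := by
  induction l generalizing g with
  | nil =>
    simp only [List.forall₂_nil_left_iff, exists_eq_left, List.prod_nil, List.map_nil,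
      List.sum_nil, Set.mem_zero]
    obtain ⟨h₁, h₂, h₃, h₄, h₅, h₆⟩ := coord_one (F := F)
    constructor
    · rintro rfl
      refine ⟨h₁, h₃, ?_⟩
      simp [twist, h₂, h₃, h₄, h₅, h₆]
    · rintro ⟨ha, hc, ht⟩
      simp only [twist, hc, zero_mul, sub_zero, Prod.mk_eq_zero] at ht
      exact ext_coord (h₁.trans ha.symm) (h₂.trans ht.1.symm) (h₃.trans hc.symm)
        (h₄.trans ht.2.1.symm) (h₅.trans ht.2.2.1.symm) (h₆.trans ht.2.2.2.symm)
  | cons x l ih =>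
    simp only [List.map_cons, List.sum_cons]
    constructor
    · rintro ⟨l', hl, rfl⟩
      obtain ⟨_, l'', ⟨z, rfl⟩, hl', rfl⟩ := List.forall₂_cons_left_iff.1 hl
      obtain ⟨h₁, h₂, h₃⟩ := (ih l''.prod).1 ⟨l'', hl', rfl⟩
      obtain ⟨ea, ec, -⟩ := conj_coord x z
      rw [List.prod_cons, a_mul, c_mul, twist_mul, h₁, h₂, ea, ec]
      exact ⟨rfl, rfl, Set.add_mem_add ((mem_orbit_iff ..).2 ⟨z, rfl⟩)
        (shift_mem_sum_orbit _ _ _ h₃)⟩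
    · rintro ⟨h₁, h₂, h₃⟩
      obtain ⟨t, ht, u, hu, htu⟩ := Set.mem_add.1 h₃
      obtain ⟨z, rfl⟩ := (mem_orbit_iff ..).1 ht
      obtain ⟨ea, ec, -⟩ := conj_coord x z
      generalize hy : z⁻¹ * x * z = y at *
      have e₁ : a g = a y + a (y⁻¹ * g) := by rw [← a_mul]; simp
      have e₂ : c g = c y + c (y⁻¹ * g) := by rw [← c_mul]; simp
      have e₃ : twist g = twist y + shift (a y) (c y) (twist (y⁻¹ * g)) := by
        rw [← twist_mul]; simp
      have e₄ : shift (a y) (c y) (twist (y⁻¹ * g)) = u := by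
        rw [← htu] at e₃
        exact (add_left_cancel e₃).symm
      obtain ⟨l', hl, hp⟩ := (ih (y⁻¹ * g)).2 ⟨by rw [e₁, ea] at h₁; exact add_left_cancel h₁,
        by rw [e₂, ec] at h₂; exact add_left_cancel h₂, by
          rw [← shift_neg_shift (a y) (c y) (twist (y⁻¹ * g)), e₄]
          exact shift_mem_sum_orbit _ _ _ hu⟩
      exact ⟨y :: l', .cons ⟨z, hy.symm⟩ hl, by rw [List.prod_cons, hp]; simp⟩

/-- Solvability of a spherical equation as a question about a Minkowski sum. -/
theorem mem_sphEq_iff (l : List (UT F)) : l ∈ SphEq (UT F) ↔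
    (l.map a).sum = 0 ∧ (l.map c).sum = 0 ∧ 0 ∈ (l.map orbit).sum := by
  have h : l ∈ SphEq (UT F) ↔
      ∃ l' : List (UT F), List.Forall₂ (fun x y => ∃ z, y = z⁻¹ * x * z) l l' ∧ l'.prod = 1 := by
    constructor
    · rintro ⟨z, hz⟩
      refine ⟨_, List.forall₂_iff_get.2 ⟨by simp, fun i h₁ h₂ => ⟨z ⟨i, h₁⟩, ?_⟩⟩, hz⟩
      simp
    · rintro ⟨l', hl, hp⟩
      obtain ⟨hlen, hl⟩ := List.forall₂_iff_get.1 hl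
      choose z hz using fun i : Fin l.length => hl i i.2 (hlen ▸ i.2)
      refine ⟨z, ?_⟩
      rw [← hp]
      congr 1
      refine List.ext_get (by simp [hlen]) fun i h₁ h₂ => ?_
      rw [List.get_ofFn]
      exact (hz ⟨i, hlen ▸ h₂⟩).symm
  rw [h, exists_conj_prod_iff]
  obtain ⟨h₁, h₂, h₃, h₄, h₅, h₆⟩ := coord_one (F := F)
  have ht : twist (1 : UT F) = 0 := by simp [twist, h₂, h₃, h₄, h₅, h₆]
  rw [ht, h₁, h₃, eq_comm, @eq_comm _ 0 (l.map c).sum]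

end UT4

/-! ### Deciding membership in the Minkowski sum -/

namespace UT4

open scoped Pointwise

variable {F : Type} [Field F]

theorem mem_orbit (g : UT F) : (b g, d g, e g, f g) ∈ orbit g :=
  ⟨rfl, 0, 0, 0, 0, 0, by simp, by simp, by simp⟩

theorem mem_sum_orbit (l : List (UT F)) :
    ((l.map b).sum, (l.map d).sum, (l.map e).sum, (l.map f).sum) ∈ (l.map orbit).sum := by
  induction l with
  | nil => exact Set.mem_zero.2 rfl
  | cons g l ih => exact Set.add_mem_add (mem_orbit g) ih

theorem fst_of_mem_sum_orbit {l : List (UT F)} {t : F × F × F × F} (ht : t ∈ (l.map orbit).sum) :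
    t.1 = (l.map b).sum := by
  induction l generalizing t with
  | nil => rw [Set.mem_zero.1 ht]; rfl
  | cons g l ih =>
    obtain ⟨u, hu, v, hv, rfl⟩ := Set.mem_add.1 ht
    simp [ih hv, hu.1]

theorem sum_orbit_append (l m : List (UT F)) :
    ((l ++ m).map orbit).sum = (l.map orbit).sum + (m.map orbit).sum := by
  rw [List.map_append, List.sum_append]

theorem sum_orbit_perm {l m : List (UT F)} (h : l.Perm m) :
    (l.map orbit).sum = (m.map orbit).sum := (h.map orbit).sum_eq

/-- The Minkowski sum over `l` is as large as possible: it consists of all quadruples whose first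
component is the sum of the entries `b`. -/
def IsFull (l : List (UT F)) : Prop :=
  ∀ t : F × F × F × F, t.1 = (l.map b).sum → t ∈ (l.map orbit).sum

/-- A part of the list with full Minkowski sum suffices. -/
theorem IsFull.zero_mem {l m k : List (UT F)} (hm : IsFull m) (h : l.Perm (m ++ k))
    (hb : (l.map b).sum = 0) : (0 : F × F × F × F) ∈ (l.map orbit).sum := by
  rw [sum_orbit_perm h, sum_orbit_append]
  rw [(h.map b).sum_eq, List.map_append, List.sum_append] at hb
  refine Set.mem_add.2 ⟨_, hm (-((k.map b).sum, (k.map d).sum, (k.map e).sum, (k.map f).sum)) ?_,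
    _, mem_sum_orbit k, neg_add_cancel _⟩
  simp only [Prod.fst_neg]
  linear_combination -hb

theorem exists_mul_sub_mul_eq {x y : F} (h : x ≠ 0 ∨ y ≠ 0) (r : F) : ∃ n m, x * n - y * m = r := by
  rcases h with h | h
  · exact ⟨r / x, 0, by field_simp; ring⟩
  · exact ⟨0, -r / y, by field_simp; ring⟩

theorem isFull_singleton {x : UT F} (hac : a x ≠ 0 ∨ c x ≠ 0) (hb : b x ≠ 0) : IsFull [x] := by
  intro t ht
  simp only [List.map_cons, List.map_nil, List.sum_cons, List.sum_nil, add_zero] at ht ⊢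
  obtain ⟨n, m, hr⟩ := exists_mul_sub_mul_eq hac (t.2.2.2 - (f x + (t.2.1 - d x) / b x * e x +
    (t.2.2.1 - e x) / b x * d x + (t.2.1 - d x) / b x * ((t.2.2.1 - e x) / b x) * b x))
  refine ⟨ht, (t.2.1 - d x) / b x, (t.2.2.1 - e x) / b x, 0, m, n, ?_, ?_, ?_⟩
  · field_simp; ring
  · field_simp; ring
  · rw [hr]; ring

theorem isFull_pair_of_mem {x y : UT F} (h : ∀ t : F × F × F × F, t.1 = b x + b y →
    ∃ u ∈ orbit x, t - u ∈ orbit y) : IsFull [x, y] := by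
  intro t ht
  simp only [List.map_cons, List.map_nil, List.sum_cons, List.sum_nil, add_zero] at ht ⊢
  obtain ⟨u, hu, hv⟩ := h t ht
  exact Set.mem_add.2 ⟨u, hu, _, hv, add_sub_cancel _ _⟩

/-- If `b ≠ 0`, the entries `D`, `E` of an element of the orbit are arbitrary, and the last entry is
determined by them if `n = m = 0`, since `M ↦ U(X) M U(W)` preserves the determinant. -/
theorem exists_mem_orbit {x : UT F} (hb : b x ≠ 0) (D E : F) :
    ∃ t ∈ orbit x, t.1 = b x ∧ t.2.1 = D ∧ t.2.2.1 = E ∧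
      t.2.2.2 = (D * E - d x * e x + f x * b x) / b x := by
  refine ⟨(b x, D, E, (D * E - d x * e x + f x * b x) / b x),
    ⟨rfl, (D - d x) / b x, (E - e x) / b x, 0, 0, 0, ?_, ?_, ?_⟩, rfl, rfl, rfl, rfl⟩ <;>
    field_simp <;> ring

theorem isFull_pair {x y : UT F} (hac : a y ≠ 0 ∨ c y ≠ 0) (hb : b x ≠ 0) : IsFull [x, y] := by
  refine isFull_pair_of_mem fun t ht => ?_
  obtain ⟨u, hu, h₁, h₂, h₃, h₄⟩ := exists_mem_orbit hb (t.2.1 - d y) (t.2.2.1 - e y)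
  obtain ⟨n, m, hr⟩ := exists_mul_sub_mul_eq hac (t.2.2.2 - u.2.2.2 - f y)
  refine ⟨u, hu, ?_, 0, 0, 0, m, n, ?_, ?_, ?_⟩
  · rw [Prod.fst_sub, ht, h₁]; ring
  · simp [h₂]
  · simp [h₃]
  · rw [hr]; simp

theorem isFull_pair_of_ne {x y : UT F} (h : a x * c y ≠ c x * a y) : IsFull [x, y] := by
  refine isFull_pair_of_mem fun t ht => ?_
  have hΔ : a x * c y - c x * a y ≠ 0 := sub_ne_zero.2 h
  have hac : a y ≠ 0 ∨ c y ≠ 0 := by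
    by_contra! h'
    simp [h'] at h
  obtain ⟨s, s', h₁, h₂⟩ : ∃ s s', a x * s + a y * s' = t.2.1 - d x - d y ∧
      -(c x * s) - c y * s' = t.2.2.1 - e x - e y := by
    generalize t.2.1 - d x - d y = r
    generalize t.2.2.1 - e x - e y = q
    generalize hD : a x * c y - c x * a y = Δ at hΔ
    refine ⟨(r * c y + q * a y) / Δ, -(r * c x + q * a x) / Δ, ?_, ?_⟩ <;>
      field_simp <;> rw [← hD] <;> ring
  obtain ⟨n, m, hn⟩ := exists_mul_sub_mul_eq hac (t.2.2.2 - f x - f y)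
  refine ⟨(b x, d x + a x * s, e x - c x * s, f x), ⟨rfl, 0, 0, s, 0, 0, by simp, by simp, by simp⟩,
    by simp [ht], 0, 0, s', m, n, ?_, ?_, ?_⟩
  · simp only [Prod.snd_sub, Prod.fst_sub]
    linear_combination -h₁
  · simp only [Prod.snd_sub, Prod.fst_sub]
    linear_combination -h₂
  · rw [hn]; simp

theorem isFull_pair_of_eq_zero {x y : UT F} (hb : b x ≠ 0) (hb' : b y = 0)
    (hde : d y ≠ 0 ∨ e y ≠ 0) : IsFull [x, y] := by
  refine isFull_pair_of_mem fun t ht => ?_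
  obtain ⟨u, hu, h₁, h₂, h₃, h₄⟩ := exists_mem_orbit hb (t.2.1 - d y) (t.2.2.1 - e y)
  obtain ⟨W, X, hr⟩ := exists_mul_sub_mul_eq hde (t.2.2.2 - u.2.2.2 - f y)
  refine ⟨u, hu, ?_, -X, W, 0, 0, 0, ?_, ?_, ?_⟩
  · rw [Prod.fst_sub, ht, h₁]; ring
  · simp [h₂, hb']
  · simp [h₃, hb']
  · simp only [Prod.snd_sub, hb']
    linear_combination -hr

/-- The twists of three elements with nonzero `b` are quadruples `(b, D, E, (DE - δ) / b)` with
arbitrary `D` and `E`; choosing `D = 1, D' - 1, 0` and `E = v, 0, E' - v` makes only one of the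
products nonzero and equal to `v`. -/
theorem isFull_triple {x y z : UT F} (hx : b x ≠ 0) (hy : b y ≠ 0) (hz : b z ≠ 0) :
    IsFull [x, y, z] := by
  intro t ht
  simp only [List.map_cons, List.map_nil, List.sum_cons, List.sum_nil, add_zero] at ht ⊢
  set w := b x * (t.2.2.2 - (-d x * e x + f x * b x) / b x - (-d y * e y + f y * b y) / b y -
    (-d z * e z + f z * b z) / b z) with hw
  obtain ⟨u, hu, hu₁, hu₂, hu₃, hu₄⟩ := exists_mem_orbit hx 1 w
  obtain ⟨v, hv, hv₁, hv₂, hv₃, hv₄⟩ := exists_mem_orbit hy (t.2.1 - 1) 0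
  obtain ⟨k, hk, hk₁, hk₂, hk₃, hk₄⟩ := exists_mem_orbit hz 0 (t.2.2.1 - w)
  have e : t = u + (v + k) := by
    ext
    · simp [ht, hu₁, hv₁, hk₁]
    · simp [hu₂, hv₂, hk₂]
    · simp [hu₃, hv₃, hk₃]
    · simp only [Prod.snd_add, hu₄, hv₄, hk₄, hw]
      field_simp
      ring
  rw [e]
  exact Set.add_mem_add hu (Set.add_mem_add hv hk)

/-- The case that `(a, c)` does not vanish identically. -/
theorem zero_mem_sum_orbit_iff_of_ne {l : List (UT F)} {x : UT F} (hx : x ∈ l)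
    (hac : a x ≠ 0 ∨ c x ≠ 0) (hb : (l.map b).sum = 0) :
    (0 : F × F × F × F) ∈ (l.map orbit).sum ↔ (∃ y ∈ l, b y ≠ 0) ∨
      (∃ y ∈ l, a x * c y ≠ c x * a y) ∨ c x * (l.map d).sum + a x * (l.map e).sum = 0 := by
  classical
  have hp := List.perm_cons_erase hx
  have hp₂ : ∀ y ∈ l, y ≠ x → l.Perm ([x, y] ++ (l.erase x).erase y) := fun y hy hyx =>
    hp.trans (.cons x (List.perm_cons_erase ((List.mem_erase_of_ne hyx).2 hy)))
  by_cases h₁ : ∃ y ∈ l, b y ≠ 0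
  · simp only [h₁, true_or, iff_true]
    obtain ⟨y, hy, hby⟩ := h₁
    by_cases hbx : b x = 0
    · exact (isFull_pair hac hby).zero_mem
        ((hp₂ y hy fun h => hby (h ▸ hbx)).trans (.swap ..)) hb
    · exact (isFull_singleton hac hbx).zero_mem hp hb
  by_cases h₂ : ∃ y ∈ l, a x * c y ≠ c x * a y
  · simp only [h₂, true_or, or_true, iff_true]
    obtain ⟨y, hy, hxy⟩ := h₂
    exact (isFull_pair_of_ne hxy).zero_mem
      (hp₂ y hy fun h => hxy (by rw [h, mul_comm])) hb
  simp only [h₁, h₂, false_or]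
  push Not at h₁ h₂
  constructor
  · intro h
    -- The linear form `c x * D + a x * E` is constant on every orbit.
    have key : ∀ (m : List (UT F)), (∀ y ∈ m, y ∈ l) → ∀ t ∈ (m.map orbit).sum,
        c x * t.2.1 + a x * t.2.2.1 = c x * (m.map d).sum + a x * (m.map e).sum := by
      intro m
      induction m with
      | nil => rintro - t ht; rw [Set.mem_zero.1 ht]; rfl
      | cons y m ih =>
        intro hm t ht
        obtain ⟨u, ⟨-, X, W, s, -, -, hu₁, hu₂, -⟩, v, hv, rfl⟩ := Set.mem_add.1 ht
        have h₃ := ih (fun z hz => hm z (List.mem_cons_of_mem _ hz)) v hv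
        have h₄ := h₂ y (hm y List.mem_cons_self)
        rw [h₁ y (hm y List.mem_cons_self)] at hu₁ hu₂
        simp only [Prod.fst_add, Prod.snd_add, List.map_cons, List.sum_cons, hu₁, hu₂]
        linear_combination h₃ - s * h₄
    have := key l (fun _ h => h) 0 h
    simpa using this.symm
  · intro h
    rw [(hp.map d).sum_eq, (hp.map e).sum_eq, List.map_cons, List.map_cons, List.sum_cons,
      List.sum_cons] at h
    rw [(hp.map b).sum_eq, List.map_cons, List.sum_cons] at hb
    rw [sum_orbit_perm hp, List.map_cons, List.sum_cons]
    refine Set.mem_add.2 ⟨_, ?_, _, mem_sum_orbit (l.erase x), neg_add_cancel _⟩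
    obtain ⟨n, m, hn⟩ := exists_mul_sub_mul_eq hac (-((l.erase x).map f).sum - f x)
    obtain ⟨s, hs, hs'⟩ : ∃ s, -((l.erase x).map d).sum = d x + a x * s ∧
        -((l.erase x).map e).sum = e x - c x * s := by
      rcases hac with h0 | h0
      · refine ⟨-(d x + ((l.erase x).map d).sum) / a x, ?_, ?_⟩
        · field_simp; ring
        · field_simp
          linear_combination -h
      · refine ⟨(e x + ((l.erase x).map e).sum) / c x, ?_, ?_⟩
        · field_simp
          linear_combination -h
        · field_simp; ring
    refine ⟨?_, 0, 0, s, m, n, ?_, ?_, ?_⟩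
    · simp only [Prod.fst_neg]
      linear_combination -hb
    · simpa using hs
    · simpa using hs'
    · simp [hn]

/-- The case that `a`, `b` and `c` vanish identically. -/
theorem zero_mem_sum_orbit_iff_of_eq_zero {l : List (UT F)} (ha : ∀ x ∈ l, a x = 0)
    (hc : ∀ x ∈ l, c x = 0) (hb : ∀ x ∈ l, b x = 0) :
    (0 : F × F × F × F) ∈ (l.map orbit).sum ↔ (l.map d).sum = 0 ∧ (l.map e).sum = 0 ∧
      ((∃ x ∈ l, d x ≠ 0 ∨ e x ≠ 0) ∨ (l.map f).sum = 0) := by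
  classical
  have hb0 : (l.map b).sum = 0 := List.sum_eq_zero fun y hy => by
    obtain ⟨x, hx, rfl⟩ := List.mem_map.1 hy
    exact hb x hx
  constructor
  · intro h
    have key : ∀ (m : List (UT F)), (∀ y ∈ m, y ∈ l) → ∀ t ∈ (m.map orbit).sum,
        t.2.1 = (m.map d).sum ∧ t.2.2.1 = (m.map e).sum ∧
          ((∀ x ∈ m, d x = 0 ∧ e x = 0) → t.2.2.2 = (m.map f).sum) := by
      intro m
      induction m with
      | nil => rintro - t ht; rw [Set.mem_zero.1 ht]; simp
      | cons y m ih =>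
        intro hm t ht
        obtain ⟨u, ⟨-, X, W, s, k, k', hu₁, hu₂, hu₃⟩, v, hv, rfl⟩ := Set.mem_add.1 ht
        obtain ⟨h₃, h₄, h₅⟩ := ih (fun z hz => hm z (List.mem_cons_of_mem _ hz)) v hv
        have hy := hm y List.mem_cons_self
        rw [hb y hy, ha y hy] at hu₁
        rw [hb y hy, hc y hy] at hu₂
        rw [hb y hy, ha y hy, hc y hy] at hu₃
        refine ⟨by simp [hu₁, h₃], by simp [hu₂, h₄], fun h0 => ?_⟩
        obtain ⟨h₆, h₇⟩ := h0 y List.mem_cons_self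
        simp [hu₃, h₆, h₇, h₅ fun z hz => h0 z (List.mem_cons_of_mem _ hz)]
    obtain ⟨h₁, h₂, h₃⟩ := key l (fun _ h => h) 0 h
    refine ⟨h₁.symm, h₂.symm, or_iff_not_imp_left.2 fun h₄ => (h₃ ?_).symm⟩
    push Not at h₄
    exact h₄
  · rintro ⟨h₁, h₂, ⟨x, hx, hde⟩ | h₃⟩
    · have hp := List.perm_cons_erase hx
      rw [(hp.map d).sum_eq, List.map_cons, List.sum_cons] at h₁
      rw [(hp.map e).sum_eq, List.map_cons, List.sum_cons] at h₂
      rw [(hp.map b).sum_eq, List.map_cons, List.sum_cons] at hb0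
      rw [sum_orbit_perm hp, List.map_cons, List.sum_cons]
      refine Set.mem_add.2 ⟨_, ?_, _, mem_sum_orbit (l.erase x), neg_add_cancel _⟩
      obtain ⟨W, X, hn⟩ := exists_mul_sub_mul_eq hde (-((l.erase x).map f).sum - f x)
      refine ⟨?_, -X, W, 0, 0, 0, ?_, ?_, ?_⟩
      · simp only [Prod.fst_neg]
        linear_combination -hb0
      · simp only [Prod.fst_neg, Prod.snd_neg, hb x hx]
        linear_combination -h₁
      · simp only [Prod.fst_neg, Prod.snd_neg, hb x hx]
        linear_combination -h₂
      · simp only [Prod.snd_neg, hb x hx]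
        linear_combination -hn
    · have := mem_sum_orbit l
      rwa [h₁, h₂, h₃, hb0] at this

/-- The case that `a` and `c` vanish identically, but `b` does not. -/
theorem zero_mem_sum_orbit_iff_of_exists [DecidableEq F] {l : List (UT F)} (ha : ∀ x ∈ l, a x = 0)
    (hc : ∀ x ∈ l, c x = 0) (hb : ∃ x ∈ l, b x ≠ 0) (hb0 : (l.map b).sum = 0) :
    (0 : F × F × F × F) ∈ (l.map orbit).sum ↔ (∃ x ∈ l, b x = 0 ∧ (d x ≠ 0 ∨ e x ≠ 0)) ∨
      3 ≤ (l.filter fun x => b x ≠ 0).length ∨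
      ∃ x y, (l.filter fun x => b x ≠ 0) = [x, y] ∧ d x * e x + f y * b y =
        f x * b x + d y * e y + b x * ((l.filter fun x => b x = 0).map f).sum := by
  by_cases h₁ : ∃ x ∈ l, b x = 0 ∧ (d x ≠ 0 ∨ e x ≠ 0)
  · simp only [h₁, true_or, iff_true]
    obtain ⟨x, hx, hbx, hde⟩ := h₁
    obtain ⟨y, hy, hby⟩ := hb
    exact (isFull_pair_of_eq_zero hby hbx hde).zero_mem ((List.perm_cons_erase hy).trans
      (.cons y (List.perm_cons_erase
        ((List.mem_erase_of_ne (by rintro rfl; exact hby hbx)).2 hx)))) hb0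
  simp only [h₁, false_or]
  push Not at h₁
  have hp : l.Perm ((l.filter fun x => b x ≠ 0) ++ l.filter fun x => b x = 0) := by
    simpa using (List.filter_append_perm (fun x => decide (b x ≠ 0)) l).symm
  have hne : ∀ x ∈ l.filter (fun x => b x ≠ 0), b x ≠ 0 := fun x hx => by
    simpa using (List.mem_filter.1 hx).2
  have hm : ∀ x ∈ l.filter (fun x => b x ≠ 0), x ∈ l := fun x hx => (List.mem_filter.1 hx).1
  have hnil : (l.filter fun x => b x ≠ 0) ≠ [] := by
    obtain ⟨x, hx, hbx⟩ := hb
    exact List.ne_nil_of_mem (List.mem_filter.2 ⟨hx, by simpa using hbx⟩)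
  have hsum : ((l.filter fun x => b x ≠ 0).map b).sum = 0 := by
    rw [(hp.map b).sum_eq, List.map_append, List.sum_append] at hb0
    have h0 : ((l.filter fun x => b x = 0).map b).sum = 0 := List.sum_eq_zero fun y hy => by
      obtain ⟨x, hx, rfl⟩ := List.mem_map.1 hy
      simpa using (List.mem_filter.1 hx).2
    rwa [h0, add_zero] at hb0
  have hrest : ∀ t : F × F × F × F, t ∈ ((l.filter fun x => b x = 0).map orbit).sum ↔
      t = (0, 0, 0, ((l.filter fun x => b x = 0).map f).sum) := by
    have h0 : ∀ x ∈ l.filter (fun x => b x = 0), b x = 0 ∧ a x = 0 ∧ c x = 0 ∧ d x = 0 ∧ e x = 0 := by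
      intro x hx
      obtain ⟨hx, hbx⟩ := List.mem_filter.1 hx
      have hbx : b x = 0 := by simpa using hbx
      exact ⟨hbx, ha x hx, hc x hx, h₁ x hx hbx⟩
    generalize l.filter (fun x => b x = 0) = m at h0
    induction m with
    | nil => intro t; exact Set.mem_zero
    | cons x m ih =>
      intro t
      obtain ⟨e₁, e₂, e₃, e₄, e₅⟩ := h0 x List.mem_cons_self
      have ho : orbit x = {(0, 0, 0, f x)} := by
        ext ⟨t₁, t₂, t₃, t₄⟩
        simp [orbit, e₁, e₂, e₃, e₄, e₅]
      rw [List.map_cons, List.sum_cons, ho, Set.singleton_add, Set.mem_image]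
      simp only [ih fun y hy => h0 y (List.mem_cons_of_mem _ hy), exists_eq_left]
      simp [eq_comm]
  rcases hF : (l.filter fun x => b x ≠ 0) with - | ⟨x, - | ⟨y, - | ⟨z, m⟩⟩⟩
  · exact absurd hF hnil
  · rw [hF] at hsum hne
    simp only [List.map_cons, List.map_nil, List.sum_cons, List.sum_nil, add_zero] at hsum
    exact absurd hsum (hne x (by simp))
  · rw [hF] at hsum hne hm hp
    simp only [List.map_cons, List.map_nil, List.sum_cons, List.sum_nil, add_zero] at hsum
    have hbx := hne x (by simp)
    have hby : b y = -b x := by linear_combination hsum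
    have hax := ha x (hm x (by simp))
    have hay := ha y (hm y (by simp))
    have hcx := hc x (hm x (by simp))
    have hcy := hc y (hm y (by simp))
    rw [sum_orbit_perm hp, sum_orbit_append]
    generalize ((l.filter fun x => b x = 0).map f).sum = Φ at *
    simp only [hF, List.length_cons, List.length_nil, Nat.reduceAdd, Nat.reduceLeDiff, false_or]
    constructor
    · intro h
      obtain ⟨t, ht, u, hu, htu⟩ := Set.mem_add.1 h
      rw [hrest] at hu
      subst hu
      simp only [List.map_cons, List.map_nil, List.sum_cons, List.sum_nil, add_zero] at ht
      obtain ⟨v, ⟨hv₁, X, W, s, k, k', hv₂, hv₃, hv₄⟩, w, ⟨hw₁, X', W', s', j, j', hw₂, hw₃, hw₄⟩,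
        rfl⟩ := Set.mem_add.1 ht
      simp only [Prod.ext_iff, Prod.fst_add, Prod.snd_add, Prod.fst_zero, Prod.snd_zero, add_zero,
        hv₁, hv₂, hv₃, hv₄, hw₁, hw₂, hw₃, hw₄, hax, hay, hcx, hcy, hby, zero_mul] at htu
      obtain ⟨-, i₁, i₂, i₃⟩ := htu
      refine ⟨x, y, rfl, ?_⟩
      rw [hby]
      -- By `i₁` and `i₂`, both representatives have the same product of the entries `d` and `e`; as
      -- `b y = -b x`, these products cancel in `i₃`.
      linear_combination -b x * i₃ + (e x + b x * W) * i₁ - (d y - b x * X') * i₂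
    · rintro ⟨_, _, hxy, h⟩
      simp only [List.cons.injEq, and_true] at hxy
      obtain ⟨rfl, rfl⟩ := hxy
      refine Set.mem_add.2 ⟨(0, 0, 0, -Φ), ?_, _, (hrest _).2 rfl, by simp⟩
      simp only [List.map_cons, List.map_nil, List.sum_cons, List.sum_nil, add_zero]
      obtain ⟨u, hu, hu₁, hu₂, hu₃, hu₄⟩ := exists_mem_orbit hbx 0 0
      obtain ⟨v, hv, hv₁, hv₂, hv₃, hv₄⟩ := exists_mem_orbit (hne y (by simp)) 0 0
      refine Set.mem_add.2 ⟨u, hu, v, hv, ?_⟩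
      ext
      · simp [hu₁, hv₁, hsum]
      · simp [hu₂, hv₂]
      · simp [hu₃, hv₃]
      · simp only [Prod.snd_add, hu₄, hv₄]
        rw [hby] at h ⊢
        field_simp
        linear_combination -h
  · simp only [hF, List.length_cons, Nat.le_add_left, true_or, iff_true]
    rw [hF] at hne hp
    exact (isFull_triple (hne x (by simp)) (hne y (by simp)) (hne z (by simp))).zero_mem hp hb0

end UT4

/-! ### The program for `UT(4, p)` -/

/-- The registers of the program. -/
inductive Reg
  /-- The entries of the current matrix. -/
  | entry (i j : Fin 4)
  /-- Auxiliary registers for multiplication. -/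
  | x | y
  /-- Products. -/
  | t | u
  /-- The sums of the entries `a`, `b`, `c`, `d`, `e`. -/
  | sa | sb | sc | sd | se
  /-- The sum of the entries `f` of the matrices with `b = 0`. -/
  | sf
  /-- The entries `a` and `c` of the first matrix for which they are not both zero. -/
  | a₀ | c₀
  /-- Nonzero if some `(a, c)` is not proportional to `(a₀, c₀)`. -/
  | nc
  /-- Nonzero if `(d, e) ≠ 0` for some matrix with `b = 0`. -/
  | nz
  /-- The first, the second and the latest after the second of the nonzero entries `b`. -/
  | b₁ | b₂ | b₃
  /-- The two sides of the equation to be checked when exactly two entries `b` are nonzero. -/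
  | lhs | rhs
  deriving DecidableEq, Fintype

namespace UT4Prog

open StackProg Prog Function UT4

/-- Add the entries of the current matrix to the sums. -/
def stepSums : Prog Reg :=
  .seq (add .sa (.entry 0 1)) (.seq (add .sb (.entry 1 2)) (.seq (add .sc (.entry 2 3))
    (.seq (add .sd (.entry 0 2)) (add .se (.entry 1 3)))))

/-- Store the first nonzero `(a, c)`. -/
def stepDir : Prog Reg :=
  cond (isNonzero .a₀) skip (cond (isNonzero .c₀) skip
    (.seq (copy .a₀ (.entry 0 1)) (copy .c₀ (.entry 2 3))))

/-- Record whether `(a, c)` is not proportional to `(a₀, c₀)`. The diagonal entry `1` serves as a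
nonzero constant. -/
def stepNc : Prog Reg :=
  .seq (mul .x .y .t .a₀ (.entry 2 3)) (.seq (mul .x .y .u .c₀ (.entry 0 1))
    (cond (areDistinct .t .u) (copy .nc (.entry 0 0)) skip))

/-- Process a matrix with `b = 0`. -/
def stepZero : Prog Reg :=
  .seq (add .sf (.entry 0 3)) (cond (isNonzero (.entry 0 2)) (copy .nz (.entry 0 0))
    (cond (isNonzero (.entry 1 3)) (copy .nz (.entry 0 0)) skip))

/-- Process the first matrix with `b ≠ 0`. -/
def stepFirst : Prog Reg :=
  .seq (copy .b₁ (.entry 1 2)) (.seq (mul .x .y .lhs (.entry 0 2) (.entry 1 3))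
    (mul .x .y .rhs (.entry 0 3) (.entry 1 2)))

/-- Process the second matrix with `b ≠ 0`. -/
def stepSecond : Prog Reg :=
  .seq (copy .b₂ (.entry 1 2)) (.seq (.seq (mul .x .y .t (.entry 0 2) (.entry 1 3)) (add .rhs .t))
    (.seq (mul .x .y .t (.entry 0 3) (.entry 1 2)) (add .lhs .t)))

/-- Process the entries `b`, `d`, `e`, `f` of the current matrix. -/
def stepB : Prog Reg :=
  cond (isNonzero (.entry 1 2))
    (cond (isNonzero .b₁) (cond (isNonzero .b₂) (copy .b₃ (.entry 1 2)) stepSecond) stepFirst)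
    stepZero

variable {p n : ℕ}

section

variable [NeZero p]

theorem does_stepSums : ∃ f, Does (p := p) n stepSums f ∧ ∀ v,
    f v .sa = v .sa + v (.entry 0 1) ∧ f v .sb = v .sb + v (.entry 1 2) ∧
    f v .sc = v .sc + v (.entry 2 3) ∧ f v .sd = v .sd + v (.entry 0 2) ∧
    f v .se = v .se + v (.entry 1 3) ∧
    ∀ r ∉ [Reg.sa, .sb, .sc, .sd, .se], f v r = v r := by
  -- The functions are kept opaque, as nested updates would grow exponentially.
  have key : ∀ r s, ∃ f, Does (p := p) n (add r s : Prog Reg) f ∧ (∀ v, f v r = v r + v s) ∧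
      ∀ v, ∀ q ≠ r, f v q = v q := fun r s =>
    ⟨_, does_add r s, fun v => update_self .., fun v q hq => update_of_ne hq ..⟩
  choose f h₁ h₂ h₃ using key
  refine ⟨_, (h₁ _ _).seq ((h₁ _ _).seq ((h₁ _ _).seq ((h₁ _ _).seq (h₁ _ _)))), fun v => ?_⟩
  simp +contextual [h₂, h₃]

omit [NeZero p] in
theorem does_stepDir : ∃ f, Does (p := p) n stepDir f ∧ ∀ v,
    (v .a₀ ≠ 0 ∨ v .c₀ ≠ 0 → f v = v) ∧
    (v .a₀ = 0 ∧ v .c₀ = 0 → f v .a₀ = v (.entry 0 1) ∧ f v .c₀ = v (.entry 2 3)) ∧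
    ∀ r ∉ [Reg.a₀, .c₀], f v r = v r := by
  refine ⟨_, (tests_isNonzero _).does_cond does_skip ((tests_isNonzero _).does_cond does_skip
    ((does_copy _ _).seq (does_copy _ _))), fun v => ?_⟩
  by_cases h₁ : v .a₀ = 0 <;> by_cases h₂ : v .c₀ = 0 <;>
    simp +contextual [h₁, h₂]

theorem does_stepNc : ∃ f, Does (p := p) n stepNc f ∧ ∀ v,
    (v .a₀ * v (.entry 2 3) ≠ v .c₀ * v (.entry 0 1) → f v .nc = v (.entry 0 0)) ∧
    (v .a₀ * v (.entry 2 3) = v .c₀ * v (.entry 0 1) → f v .nc = v .nc) ∧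
    ∀ r ∉ [Reg.x, .y, .t, .u, .nc], f v r = v r := by
  refine ⟨_, (does_mul (by decide) (by decide) (by decide) (by decide)).seq
    ((does_mul (by decide) (by decide) (by decide) (by decide)).seq
      ((tests_areDistinct _ _).does_cond (does_copy _ _) does_skip)), fun v => ?_⟩
  by_cases h : v .a₀ * v (.entry 2 3) = v .c₀ * v (.entry 0 1) <;>
    simp +contextual [h]

theorem does_stepZero : ∃ f, Does (p := p) n stepZero f ∧ ∀ v,
    f v .sf = v .sf + v (.entry 0 3) ∧
    (v (.entry 0 2) ≠ 0 ∨ v (.entry 1 3) ≠ 0 → f v .nz = v (.entry 0 0)) ∧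
    (v (.entry 0 2) = 0 ∧ v (.entry 1 3) = 0 → f v .nz = v .nz) ∧
    ∀ r ∉ [Reg.sf, .nz], f v r = v r := by
  refine ⟨_, (does_add _ _).seq ((tests_isNonzero _).does_cond (does_copy _ _)
    ((tests_isNonzero _).does_cond (does_copy _ _) does_skip)), fun v => ?_⟩
  by_cases h₁ : v (.entry 0 2) = 0 <;> by_cases h₂ : v (.entry 1 3) = 0 <;>
    simp +contextual [h₁, h₂]

theorem does_stepFirst : ∃ f, Does (p := p) n stepFirst f ∧ ∀ v,
    f v .b₁ = v (.entry 1 2) ∧ f v .lhs = v (.entry 0 2) * v (.entry 1 3) ∧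
    f v .rhs = v (.entry 0 3) * v (.entry 1 2) ∧
    ∀ r ∉ [Reg.x, .y, .b₁, .lhs, .rhs], f v r = v r := by
  refine ⟨_, (does_copy _ _).seq ((does_mul (by decide) (by decide) (by decide) (by decide)).seq
    (does_mul (by decide) (by decide) (by decide) (by decide))), fun v => ?_⟩
  simp +contextual

theorem does_stepSecond : ∃ f, Does (p := p) n stepSecond f ∧ ∀ v,
    f v .b₂ = v (.entry 1 2) ∧ f v .lhs = v .lhs + v (.entry 0 3) * v (.entry 1 2) ∧
    f v .rhs = v .rhs + v (.entry 0 2) * v (.entry 1 3) ∧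
    ∀ r ∉ [Reg.x, .y, .t, .b₂, .lhs, .rhs], f v r = v r := by
  refine ⟨_, (does_copy _ _).seq
    (((does_mul (by decide) (by decide) (by decide) (by decide)).seq (does_add _ _)).seq
    ((does_mul (by decide) (by decide) (by decide) (by decide)).seq (does_add _ _))), fun v => ?_⟩
  simp +contextual

end

variable [Fact p.Prime]

/-- The registers describe the matrices with `b ≠ 0`. If there are exactly two of them, `lhs` and `rhs`
are the sides of the equation in `UT4.zero_mem_sum_orbit_iff_of_exists`, apart from its last term. -/
def HoldsB (v : Reg → ZMod p) : List (UT (ZMod p)) → Prop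
  | [] => v .b₁ = 0 ∧ v .b₂ = 0 ∧ v .b₃ = 0
  | [g] => v .b₁ = b g ∧ v .b₂ = 0 ∧ v .b₃ = 0 ∧ v .lhs = d g * e g ∧ v .rhs = f g * b g
  | [g, h] => v .b₁ = b g ∧ v .b₂ = b h ∧ v .b₃ = 0 ∧ v .lhs = d g * e g + f h * b h ∧
      v .rhs = f g * b g + d h * e h
  | _ :: _ :: _ :: _ => v .b₁ ≠ 0 ∧ v .b₂ ≠ 0 ∧ v .b₃ ≠ 0

/-- The invariant of the main loop: the registers describe the list `l` of the matrices processed so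
far. -/
structure Inv (l : List (UT (ZMod p))) (v : Reg → ZMod p) : Prop where
  sa : v .sa = (l.map a).sum
  sb : v .sb = (l.map b).sum
  sc : v .sc = (l.map c).sum
  sd : v .sd = (l.map d).sum
  se : v .se = (l.map e).sum
  sf : v .sf = ((l.filter fun x => b x = 0).map f).sum
  dir_zero : v .a₀ = 0 ∧ v .c₀ = 0 → ∀ x ∈ l, a x = 0 ∧ c x = 0
  dir : v .a₀ ≠ 0 ∨ v .c₀ ≠ 0 → ∃ x ∈ l, a x = v .a₀ ∧ c x = v .c₀
  nc : v .nc ≠ 0 ↔ ∃ x ∈ l, v .a₀ * c x ≠ v .c₀ * a x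
  nz : v .nz ≠ 0 ↔ ∃ x ∈ l, b x = 0 ∧ (d x ≠ 0 ∨ e x ≠ 0)
  holdsB : HoldsB v (l.filter fun x => b x ≠ 0)

theorem inv_nil : Inv (p := p) [] 0 where
  sa := rfl
  sb := rfl
  sc := rfl
  sd := rfl
  se := rfl
  sf := rfl
  dir_zero := by simp
  dir := by simp
  nc := by simp
  nz := by simp
  holdsB := ⟨rfl, rfl, rfl⟩

/-- The registers `entry i j` contain the entries of `g`. -/
def HoldsEntries (g : UT (ZMod p)) (v : Reg → ZMod p) : Prop :=
  ∀ i j, v (.entry i j) = g.1.1 i j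

/-- Process the current matrix. -/
def step : Prog Reg := .seq (.seq stepSums stepDir) (.seq stepNc stepB)

/-- The registers `b₁`, `b₂`, `b₃` count the matrices with `b ≠ 0`, up to three. -/
theorem HoldsB.ne_nil {v : Reg → ZMod p} {m : List (UT (ZMod p))}
    (h : HoldsB v m) (hm : ∀ x ∈ m, b x ≠ 0) : (v .b₁ ≠ 0 ↔ 1 ≤ m.length) ∧
      (v .b₂ ≠ 0 ↔ 2 ≤ m.length) ∧ (v .b₃ ≠ 0 ↔ 3 ≤ m.length) := by
  rcases m with - | ⟨x, - | ⟨y, - | ⟨z, m⟩⟩⟩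
  · obtain ⟨h₁, h₂, h₃⟩ := h
    simp [h₁, h₂, h₃]
  · obtain ⟨h₁, h₂, h₃, -⟩ := h
    simpa [h₁, h₂, h₃] using hm
  · obtain ⟨h₁, h₂, h₃, -⟩ := h
    simpa [h₁, h₂, h₃] using hm
  · obtain ⟨h₁, h₂, h₃⟩ := h
    simp [h₁, h₂, h₃]

theorem does_stepB : ∃ φ, Does (p := p) n stepB φ ∧ ∀ v g, HoldsEntries g v →
    (b g = 0 → φ v .sf = v .sf + f g ∧ (d g ≠ 0 ∨ e g ≠ 0 → φ v .nz = 1) ∧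
      (d g = 0 ∧ e g = 0 → φ v .nz = v .nz) ∧ ∀ m, HoldsB v m → HoldsB (φ v) m) ∧
    (b g ≠ 0 → φ v .sf = v .sf ∧ φ v .nz = v .nz ∧
      ∀ m, (∀ x ∈ m, b x ≠ 0) → HoldsB v m → HoldsB (φ v) (m ++ [g])) ∧
    ∀ r ∈ [Reg.sa, .sb, .sc, .sd, .se, .a₀, .c₀, .nc], φ v r = v r := by
  obtain ⟨φ₀, h₀, k₀⟩ := does_stepZero (p := p) (n := n)
  obtain ⟨φ₁, h₁, k₁⟩ := does_stepFirst (p := p) (n := n)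
  obtain ⟨φ₂, h₂, k₂⟩ := does_stepSecond (p := p) (n := n)
  refine ⟨_, (tests_isNonzero _).does_cond ((tests_isNonzero _).does_cond
    ((tests_isNonzero _).does_cond (does_copy _ _) h₂) h₁) h₀, fun v g hg => ?_⟩
  have eb : v (.entry 1 2) = b g := hg 1 2
  have ed : v (.entry 0 2) = d g := hg 0 2
  have ee : v (.entry 1 3) = e g := hg 1 3
  have ef : v (.entry 0 3) = f g := hg 0 3
  have e1 : v (.entry 0 0) = 1 := (hg 0 0).trans (g.2.2 0)
  obtain ⟨i₀, i₁, i₂, i₃⟩ := k₀ v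
  obtain ⟨j₀, j₁, j₂, j₃⟩ := k₁ v
  obtain ⟨l₀, l₁, l₂, l₃⟩ := k₂ v
  rw [ef] at i₀
  rw [ed, ee, e1] at i₁
  rw [ed, ee] at i₂
  rw [eb] at j₀ l₀
  rw [ed, ee] at j₁ l₂
  rw [eb, ef] at j₂ l₁
  by_cases hb : b g = 0
  · simp only [eb, hb, ne_eq, not_true_eq_false, if_false, false_implies, true_implies, true_and]
    refine ⟨⟨i₀, i₁, i₂, fun m hm => ?_⟩, ?_⟩
    · have e₁ := i₃ .b₁ (by decide)
      have e₂ := i₃ .b₂ (by decide)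
      have e₃ := i₃ .b₃ (by decide)
      have e₄ := i₃ .lhs (by decide)
      have e₅ := i₃ .rhs (by decide)
      rcases m with - | ⟨x, - | ⟨y, - | ⟨z, m⟩⟩⟩ <;>
        simpa only [HoldsB, e₁, e₂, e₃, e₄, e₅] using hm
    · intro r hr
      refine i₃ r ?_
      revert r
      decide
  · simp only [eb, hb, ne_eq, not_false_eq_true, if_true, false_implies, true_implies, true_and]
    refine ⟨?_, ?_⟩
    · by_cases hb₁ : v .b₁ = 0
      · simp only [hb₁, not_true_eq_false, if_false]
        refine ⟨j₃ .sf (by decide), j₃ .nz (by decide), fun m hm hB => ?_⟩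
        obtain ⟨q₁, q₂, q₃⟩ := hB.ne_nil hm
        have hm0 : m = [] := by
          rw [← List.length_eq_zero_iff]
          by_contra h
          exact q₁.2 (by omega) hb₁
        subst hm0
        exact ⟨j₀, (j₃ .b₂ (by decide)).trans hB.2.1, (j₃ .b₃ (by decide)).trans hB.2.2, j₁, j₂⟩
      by_cases hb₂ : v .b₂ = 0
      · simp only [hb₁, hb₂, not_true_eq_false, not_false_eq_true, if_true, if_false]
        refine ⟨l₃ .sf (by decide), l₃ .nz (by decide), fun m hm hB => ?_⟩
        obtain ⟨q₁, q₂, q₃⟩ := hB.ne_nil hm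
        obtain ⟨x, rfl⟩ : ∃ x, m = [x] := by
          rw [← List.length_eq_one_iff]
          have := q₁.1 hb₁
          by_contra h
          exact q₂.2 (by omega) hb₂
        obtain ⟨r₁, -, r₃, r₄, r₅⟩ := hB
        exact ⟨(l₃ .b₁ (by decide)).trans r₁, l₀, (l₃ .b₃ (by decide)).trans r₃, by rw [l₁, r₄],
          by rw [l₂, r₅]⟩
      · simp only [hb₁, hb₂, not_false_eq_true, if_true]
        refine ⟨by simp, by simp, fun m hm hB => ?_⟩
        obtain ⟨q₁, q₂, q₃⟩ := hB.ne_nil hm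
        rcases m with - | ⟨x, - | ⟨y, m⟩⟩
        · exact absurd (q₁.1 hb₁) (by simp)
        · exact absurd (q₂.1 hb₂) (by simp)
        · cases m <;> simp [HoldsB, hb₁, hb₂, hb]
    · intro r hr
      have n₁ : r ∉ [Reg.x, .y, .b₁, .lhs, .rhs] := by revert r; decide
      have n₂ : r ∉ [Reg.x, .y, .t, .b₂, .lhs, .rhs] := by revert r; decide
      have n₃ : r ≠ .b₃ := by rintro rfl; revert hr; decide
      split_ifs
      · exact j₃ r n₁
      · exact l₃ r n₂
      · exact update_of_ne n₃ ..

/-- Processing a matrix preserves the invariant of the main loop. -/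
theorem does_step : ∃ φ, Does (p := p) n step φ ∧ ∀ v g l, HoldsEntries g v →
    Inv l v → Inv (l ++ [g]) (φ v) := by
  obtain ⟨φ₁, h₁, k₁⟩ := does_stepSums (p := p) (n := n)
  obtain ⟨φ₂, h₂, k₂⟩ := does_stepDir (p := p) (n := n)
  obtain ⟨φ₃, h₃, k₃⟩ := does_stepNc (p := p) (n := n)
  obtain ⟨φ₄, h₄, k₄⟩ := does_stepB (p := p) (n := n)
  refine ⟨_, (h₁.seq h₂).seq (h₃.seq h₄), fun v g l hg hI => ?_⟩
  have g₁ : HoldsEntries g (φ₁ v) := fun i j => ((k₁ v).2.2.2.2.2 _ (by simp)).trans (hg i j)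
  generalize hv₁ : φ₁ v = v₁ at g₁
  have g₂ : HoldsEntries g (φ₂ v₁) := fun i j => ((k₂ v₁).2.2 _ (by simp)).trans (g₁ i j)
  generalize hv₂ : φ₂ v₁ = v₂ at g₂
  have g₃ : HoldsEntries g (φ₃ v₂) := fun i j => ((k₃ v₂).2.2 _ (by simp)).trans (g₂ i j)
  generalize hv₃ : φ₃ v₂ = v₃ at g₃
  obtain ⟨s₁, s₂, s₃, s₄, s₅, s₆⟩ := k₁ v
  obtain ⟨t₁, t₂, t₃⟩ := k₂ v₁
  obtain ⟨u₁, u₂, u₃⟩ := k₃ v₂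
  obtain ⟨w₁, w₂, w₃⟩ := k₄ v₃ g g₃
  rw [hv₁] at s₁ s₂ s₃ s₄ s₅ s₆
  rw [hv₂] at t₁ t₂ t₃
  rw [hv₃] at u₁ u₂ u₃
  rw [hg] at s₁ s₂ s₃ s₄ s₅
  rw [g₁, g₁] at t₂
  rw [g₂, g₂] at u₁ u₂
  rw [g₂ 0 0, g.2.2 0] at u₁
  have keep : ∀ r ∈ [Reg.sa, .sb, .sc, .sd, .se], φ₄ v₃ r = v₁ r := by
    intro r hr
    rw [w₃ r (by revert r; decide), u₃ r (by revert r; decide), t₃ r (by revert r; decide)]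
  have keepB : ∀ r ∈ [Reg.sf, .nz, .b₁, .b₂, .b₃, .lhs, .rhs], v₃ r = v r := by
    intro r hr
    rw [u₃ r (by revert r; decide), t₃ r (by revert r; decide), s₆ r (by revert r; decide)]
  have kB : ∀ m, HoldsB v m → HoldsB v₃ m := by
    intro m hm
    have e₁ := keepB .b₁ (by decide)
    have e₂ := keepB .b₂ (by decide)
    have e₃ := keepB .b₃ (by decide)
    have e₄ := keepB .lhs (by decide)
    have e₅ := keepB .rhs (by decide)
    rcases m with - | ⟨x, - | ⟨y, - | ⟨z, m⟩⟩⟩ <;>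
      simpa only [HoldsB, e₁, e₂, e₃, e₄, e₅] using hm
  have ea : φ₄ v₃ .a₀ = v₂ .a₀ := by rw [w₃ _ (by decide), u₃ _ (by decide)]
  have ec : φ₄ v₃ .c₀ = v₂ .c₀ := by rw [w₃ _ (by decide), u₃ _ (by decide)]
  have en : φ₄ v₃ .nc = v₃ .nc := w₃ _ (by decide)
  have en' : v₂ .nc = v .nc := by rw [t₃ _ (by decide), s₆ _ (by decide)]
  have e₁ : v₁ .a₀ = v .a₀ := s₆ _ (by decide)
  have e₂ : v₁ .c₀ = v .c₀ := s₆ _ (by decide)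
  rw [e₁, e₂] at t₁ t₂
  have hdir : (v .a₀ ≠ 0 ∨ v .c₀ ≠ 0) ∧ v₂ .a₀ = v .a₀ ∧ v₂ .c₀ = v .c₀ ∨
      (v .a₀ = 0 ∧ v .c₀ = 0) ∧ v₂ .a₀ = a g ∧ v₂ .c₀ = c g := by
    by_cases h : v .a₀ = 0 ∧ v .c₀ = 0
    · exact .inr ⟨h, t₂ h⟩
    · rw [not_and_or] at h
      rw [t₁ h, e₁, e₂]
      exact .inl ⟨h, rfl, rfl⟩
  constructor
  · rw [keep _ (by decide), s₁, hI.sa, List.map_append, List.sum_append]; simp [a]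
  · rw [keep _ (by decide), s₂, hI.sb, List.map_append, List.sum_append]; simp [b]
  · rw [keep _ (by decide), s₃, hI.sc, List.map_append, List.sum_append]; simp [c]
  · rw [keep _ (by decide), s₄, hI.sd, List.map_append, List.sum_append]; simp [d]
  · rw [keep _ (by decide), s₅, hI.se, List.map_append, List.sum_append]; simp [e]
  · by_cases hb : b g = 0
    · rw [(w₁ hb).1, keepB _ (by decide), hI.sf]; simp [hb]
    · rw [(w₂ hb).1, keepB _ (by decide), hI.sf]; simp [hb]
  · rw [ea, ec]
    rintro ⟨h, h'⟩ x hx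
    rcases hdir with ⟨hd, hd₁, hd₂⟩ | ⟨hd, hd₁, hd₂⟩
    · rw [hd₁] at h
      rw [hd₂] at h'
      exact absurd h' (hd.resolve_left (not_not.2 h))
    · rcases List.mem_append.1 hx with hx | hx
      · exact hI.dir_zero hd x hx
      · rw [List.mem_singleton.1 hx, ← hd₁, ← hd₂]
        exact ⟨h, h'⟩
  · rw [ea, ec]
    intro h
    rcases hdir with ⟨hd, hd₁, hd₂⟩ | ⟨hd, hd₁, hd₂⟩
    · obtain ⟨x, hx, h'⟩ := hI.dir hd
      exact ⟨x, by simp [hx], by rwa [hd₁, hd₂]⟩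
    · exact ⟨g, by simp, hd₁.symm, hd₂.symm⟩
  · rw [ea, ec, en]
    have hv : v .nc ≠ 0 ↔ ∃ x ∈ l, v₂ .a₀ * c x ≠ v₂ .c₀ * a x := by
      rcases hdir with ⟨hd, hd₁, hd₂⟩ | ⟨hd, hd₁, hd₂⟩
      · rw [hI.nc, hd₁, hd₂]
      · have hz := hI.dir_zero hd
        rw [hI.nc]
        constructor <;> rintro ⟨x, hx, h⟩ <;> simp [hz x hx] at h
    have hg' : (∃ x ∈ l ++ [g], v₂ .a₀ * c x ≠ v₂ .c₀ * a x) ↔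
        v .nc ≠ 0 ∨ v₂ .a₀ * c g ≠ v₂ .c₀ * a g := by
      rw [hv]
      constructor
      · rintro ⟨x, hx, h⟩
        rcases List.mem_append.1 hx with hx | hx
        · exact .inl ⟨x, hx, h⟩
        · exact .inr (List.mem_singleton.1 hx ▸ h)
      · rintro (⟨x, hx, h⟩ | h)
        · exact ⟨x, by simp [hx], h⟩
        · exact ⟨g, by simp, h⟩
    rw [hg']
    by_cases h : v₂ .a₀ * c g = v₂ .c₀ * a g
    · rw [u₂ h, en']; simp [h]
    · rw [u₁ h]; simp [h]
  · have hg' : (∃ x ∈ l ++ [g], b x = 0 ∧ (d x ≠ 0 ∨ e x ≠ 0)) ↔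
        v .nz ≠ 0 ∨ b g = 0 ∧ (d g ≠ 0 ∨ e g ≠ 0) := by
      rw [hI.nz]
      constructor
      · rintro ⟨x, hx, h⟩
        rcases List.mem_append.1 hx with hx | hx
        · exact .inl ⟨x, hx, h⟩
        · exact .inr (List.mem_singleton.1 hx ▸ h)
      · rintro (⟨x, hx, h⟩ | h)
        · exact ⟨x, by simp [hx], h⟩
        · exact ⟨g, by simp, h⟩
    rw [hg']
    by_cases hb : b g = 0
    · by_cases h : d g = 0 ∧ e g = 0
      · rw [(w₁ hb).2.2.1 h, keepB _ (by decide)]; simp [h]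
      · rw [not_and_or] at h
        rw [(w₁ hb).2.1 h]
        simp [hb, h]
    · rw [(w₂ hb).2.1, keepB _ (by decide)]; simp [hb]
  · rw [List.filter_append]
    by_cases hb : b g = 0
    · simpa [hb] using (w₁ hb).2.2.2 _ (kB _ hI.holdsB)
    · have := (w₂ hb).2.2 _ (fun x hx => by simpa using (List.mem_filter.1 hx).2) (kB _ hI.holdsB)
      simpa [hb] using this

end UT4Prog

/-! ### The main loop -/

namespace UT4Prog

open StackProg Prog Function UT4

variable {p n : ℕ} [Fact p.Prime]

/-- Read the entries of a matrix in the given positions. -/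
def readEntries (L : List (Fin 4 × Fin 4)) : Prog Reg :=
  (L.map fun q => readNum (.entry q.1 q.2)).foldr .seq skip

theorem exec_readEntries (g : UT (ZMod p)) (L : List (Fin 4 × Fin 4)) (i : List Γ')
    (v : Reg → ZMod p) : ∃ v' : Reg → ZMod p, Exec n (readEntries L)
      (L.flatMap (fun q => encodeNumber (g.1.1 q.1 q.2).val) ++ i, v) (i, v') ∧
      (∀ q ∈ L, v' (.entry q.1 q.2) = g.1.1 q.1 q.2) ∧
      ∀ r, (∀ j k, r ≠ .entry j k) → v' r = v r := by
  -- For the induction, positions which are not read have to be included.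
  suffices h : ∃ v' : Reg → ZMod p, Exec n (readEntries L)
      (L.flatMap (fun q => encodeNumber (g.1.1 q.1 q.2).val) ++ i, v) (i, v') ∧
      (∀ q ∈ L, v' (.entry q.1 q.2) = g.1.1 q.1 q.2) ∧
      (∀ r, (∀ j k, r ≠ .entry j k) → v' r = v r) ∧
      ∀ q ∉ L, v' (.entry q.1 q.2) = v (.entry q.1 q.2) by
    obtain ⟨v', h₁, h₂, h₃, -⟩ := h
    exact ⟨v', h₁, h₂, h₃⟩
  induction L generalizing v with
  | nil => exact ⟨v, does_skip i v, by simp, fun _ _ => rfl, fun _ _ => rfl⟩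
  | cons q L ih =>
    obtain ⟨v', h₁, h₂, h₃, h₄⟩ := ih (update v (.entry q.1 q.2) (g.1.1 q.1 q.2))
    refine ⟨v', ?_, fun q' hq' => ?_, fun r hr => ?_, fun q' hq' => ?_⟩
    · have h := exec_readNum (n := n) (Reg.entry q.1 q.2) (ZMod.val_lt (g.1.1 q.1 q.2))
        (L.flatMap (fun q => encodeNumber (g.1.1 q.1 q.2).val) ++ i) v
      rw [ZMod.natCast_zmod_val] at h
      rw [List.flatMap_cons, List.append_assoc]
      exact h.seq h₁
    · by_cases hL : q' ∈ L
      · exact h₂ q' hL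
      · obtain rfl : q' = q := (List.mem_cons.1 hq').resolve_right hL
        rw [h₄ q' hL, update_self]
    · rw [h₃ r hr, update_of_ne (hr _ _)]
    · rw [List.mem_cons, not_or] at hq'
      rw [h₄ q' hq'.2, update_of_ne]
      intro h
      rw [Reg.entry.injEq] at h
      exact hq'.1 (Prod.ext h.1 h.2)

/-- Test whether the input has not yet been read completely, and read a symbol. -/
def hasMore : Prog Reg := .seq readCh (.load fun c => { c with q := (c.ch.isSome, false) })

omit [Fact p.Prime] in
theorem execTest_hasMore (i : List Γ') (v : Reg → ZMod p) :
    ExecTest n hasMore (i, v) i.head?.isSome (i.tail, v) := fun c W hW _ =>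
  ⟨{ c with ch := i.head?, q := (i.head?.isSome, false) }, W, rfl, rfl, hW, _, runs_readCh .., rfl⟩

/-- Read the rest of a matrix, of which the opening bracket has been read, and process it. -/
def processMatrix : Prog Reg :=
  .seq (readEntries ((List.finRange 4).flatMap fun i => (List.finRange 4).map fun j => (i, j)))
    (.seq readCh step)

theorem Inv.congr {l : List (UT (ZMod p))} {v v' : Reg → ZMod p} (h : Inv l v)
    (hv : ∀ r, (∀ j k, r ≠ .entry j k) → v' r = v r) : Inv l v' := by
  obtain ⟨h₁, h₂, h₃, h₄, h₅, h₆, h₇, h₈, h₉, h₁₀, h₁₁⟩ := h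
  rw [← hv .sa (by simp)] at h₁
  rw [← hv .sb (by simp)] at h₂
  rw [← hv .sc (by simp)] at h₃
  rw [← hv .sd (by simp)] at h₄
  rw [← hv .se (by simp)] at h₅
  rw [← hv .sf (by simp)] at h₆
  rw [← hv .a₀ (by simp), ← hv .c₀ (by simp)] at h₇ h₈ h₉
  rw [← hv .nc (by simp)] at h₉
  rw [← hv .nz (by simp)] at h₁₀
  refine ⟨h₁, h₂, h₃, h₄, h₅, h₆, h₇, h₈, h₉, h₁₀, ?_⟩
  revert h₁₁
  generalize l.filter (fun x => b x ≠ 0) = m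
  have e₁ := hv .b₁ (by simp)
  have e₂ := hv .b₂ (by simp)
  have e₃ := hv .b₃ (by simp)
  have e₄ := hv .lhs (by simp)
  have e₅ := hv .rhs (by simp)
  rcases m with - | ⟨x, - | ⟨y, - | ⟨z, m⟩⟩⟩ <;>
    simp only [HoldsB, e₁, e₂, e₃, e₄, e₅] <;> exact id

theorem exec_processMatrix {l : List (UT (ZMod p))} {v : Reg → ZMod p} (h : Inv l v)
    (g : UT (ZMod p)) (i : List Γ') : ∃ v' : Reg → ZMod p,
      Exec n processMatrix ((encodeUT4 g ++ i).tail, v) (i, v') ∧ Inv (l ++ [g]) v' := by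
  obtain ⟨v₁, h₁, h₂, h₃⟩ := exec_readEntries (n := n) g
    ((List.finRange 4).flatMap fun i => (List.finRange 4).map fun j => (i, j)) (Γ'.ket :: i) v
  obtain ⟨φ, hφ, hφ'⟩ := does_step (p := p) (n := n)
  refine ⟨φ v₁, ?_, hφ' v₁ g l (fun j k => h₂ (j, k) (by simp)) (h.congr h₃)⟩
  have hk : Exec n readCh (Γ'.ket :: i, v₁) (i, v₁) := fun c W hW _ =>
    ⟨_, W, rfl, hW, runs_readCh ..⟩
  have e : (encodeUT4 g ++ i).tail =
      ((List.finRange 4).flatMap fun i => (List.finRange 4).map fun j => (i, j)).flatMap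
        (fun q => encodeNumber (g.1.1 q.1 q.2).val) ++ Γ'.ket :: i := by
    simp [encodeUT4, List.flatMap_assoc, List.flatMap_map]
  rw [e]
  exact h₁.seq (hk.seq (hφ i v₁))

/-- Read and process all matrices. -/
def mainLoop : Prog Reg := repeatWhile hasMore processMatrix

theorem exec_mainLoop (l : List (UT (ZMod p))) (hn : l.length ≤ n) : ∃ v : Reg → ZMod p,
    Exec n mainLoop (l.flatMap encodeUT4, (0 : Reg → ZMod p)) ([], v) ∧ Inv l v := by
  have key : ∀ (l m : List (UT (ZMod p))) (v : Reg → ZMod p), Inv m v →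
      ∃ v' : Reg → ZMod p, RelIter (fun s t => ∃ u, ExecTest n hasMore s true u ∧
        Exec n processMatrix u t) l.length (l.flatMap encodeUT4, v) ([], v') ∧
        Inv (m ++ l) v' := by
    intro l
    induction l with
    | nil => exact fun m v h => ⟨v, rfl, by simpa using h⟩
    | cons g l ih =>
      intro m v h
      obtain ⟨v₁, h₁, h₂⟩ := exec_processMatrix (n := n) h g (l.flatMap encodeUT4)
      obtain ⟨v₂, h₃, h₄⟩ := ih (m ++ [g]) v₁ h₂
      have ht := execTest_hasMore (n := n) (encodeUT4 g ++ l.flatMap encodeUT4) v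
      exact ⟨v₂, ⟨_, ⟨_, ht, h₁⟩, h₃⟩, by simpa using h₄⟩
  obtain ⟨v, h₁, h₂⟩ := key l [] 0 inv_nil
  exact ⟨v, Exec.repeatWhile hn h₁ (execTest_hasMore [] v), by simpa using h₂⟩

/-! ### The final decision -/

/-- The decision in the case that `(a, c)` does not vanish identically. -/
def decideDir : Prog Reg :=
  cond (isNonzero .b₁) accept (cond (isNonzero .nc) accept
    (.seq (.seq (mul .x .y .t .c₀ .sd) (.seq (mul .x .y .u .a₀ .se) (add .t .u)))
      (cond (isNonzero .t) reject accept)))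

/-- The decision in the case that `a` and `c` vanish identically. -/
def decideZero : Prog Reg :=
  cond (isNonzero .b₁)
    (cond (isNonzero .nz) accept (cond (isNonzero .b₃) accept
      (.seq (.seq (mul .x .y .t .b₁ .sf) (add .rhs .t))
        (cond (areDistinct .lhs .rhs) reject accept))))
    (cond (isNonzero .sd) reject (cond (isNonzero .se) reject
      (cond (isNonzero .nz) accept (cond (isNonzero .sf) reject accept))))

/-- The decision. -/
def decideAll : Prog Reg :=
  cond (isNonzero .sa) reject (cond (isNonzero .sb) reject (cond (isNonzero .sc) reject
    (cond (isNonzero .a₀) decideDir (cond (isNonzero .c₀) decideDir decideZero))))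

theorem decides_decideDir : Decides (p := p) n decideDir fun v =>
    v .b₁ ≠ 0 ∨ v .nc ≠ 0 ∨ v .c₀ * v .sd + v .a₀ * v .se = 0 := by
  have h := (tests_isNonzero (p := p) (n := n) Reg.b₁).decides_cond decides_accept
    ((tests_isNonzero Reg.nc).decides_cond decides_accept
      (((does_mul (x := Reg.x) (y := .y) (d := .t) (a := .c₀) (b := .sd)
          (by decide) (by decide) (by decide) (by decide)).seq
        ((does_mul (x := Reg.x) (y := .y) (d := .u) (a := .a₀) (b := .se)
          (by decide) (by decide) (by decide) (by decide)).seq (does_add .t .u))).decides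
        ((tests_isNonzero Reg.t).decides_cond decides_reject decides_accept)))
  refine h.congr fun v => ?_
  by_cases h₁ : v .b₁ = 0 <;> by_cases h₂ : v .nc = 0 <;> simp [h₁, h₂]

theorem decides_decideZero : Decides (p := p) n decideZero fun v =>
    v .b₁ ≠ 0 ∧ (v .nz ≠ 0 ∨ v .b₃ ≠ 0 ∨ v .lhs = v .rhs + v .b₁ * v .sf) ∨
      v .b₁ = 0 ∧ v .sd = 0 ∧ v .se = 0 ∧ (v .nz ≠ 0 ∨ v .sf = 0) := by
  have h := (tests_isNonzero (p := p) (n := n) Reg.b₁).decides_cond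
    ((tests_isNonzero Reg.nz).decides_cond decides_accept
      ((tests_isNonzero Reg.b₃).decides_cond decides_accept
        (((does_mul (x := Reg.x) (y := .y) (d := .t) (a := .b₁) (b := .sf)
          (by decide) (by decide) (by decide) (by decide)).seq (does_add .rhs .t)).decides
        ((tests_areDistinct Reg.lhs .rhs).decides_cond decides_reject decides_accept))))
    ((tests_isNonzero Reg.sd).decides_cond decides_reject
      ((tests_isNonzero Reg.se).decides_cond decides_reject
        ((tests_isNonzero Reg.nz).decides_cond decides_accept
          ((tests_isNonzero Reg.sf).decides_cond decides_reject decides_accept))))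
  refine h.congr fun v => ?_
  by_cases h₁ : v .b₁ = 0 <;> by_cases h₂ : v .nz = 0 <;> by_cases h₃ : v .b₃ = 0 <;>
    simp [h₁, h₂, h₃]

theorem decides_decideAll : Decides (p := p) n decideAll fun v =>
    v .sa = 0 ∧ v .sb = 0 ∧ v .sc = 0 ∧
    ((v .a₀ ≠ 0 ∨ v .c₀ ≠ 0) ∧
      (v .b₁ ≠ 0 ∨ v .nc ≠ 0 ∨ v .c₀ * v .sd + v .a₀ * v .se = 0) ∨
    (v .a₀ = 0 ∧ v .c₀ = 0) ∧
      (v .b₁ ≠ 0 ∧ (v .nz ≠ 0 ∨ v .b₃ ≠ 0 ∨ v .lhs = v .rhs + v .b₁ * v .sf) ∨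
      v .b₁ = 0 ∧ v .sd = 0 ∧ v .se = 0 ∧ (v .nz ≠ 0 ∨ v .sf = 0))) := by
  have h := (tests_isNonzero (p := p) (n := n) Reg.sa).decides_cond decides_reject
    ((tests_isNonzero Reg.sb).decides_cond decides_reject
      ((tests_isNonzero Reg.sc).decides_cond decides_reject
        ((tests_isNonzero Reg.a₀).decides_cond decides_decideDir
          ((tests_isNonzero Reg.c₀).decides_cond decides_decideDir decides_decideZero))))
  refine h.congr fun v => ?_
  by_cases h₁ : v .a₀ = 0 <;> by_cases h₂ : v .c₀ = 0 <;> simp [h₁, h₂]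

omit [Fact p.Prime] in
theorem sum_map_filter_ne {F G : Type} [Field F] [DecidableEq F] (β : G → F) (l : List G) :
    ((l.filter fun x => β x ≠ 0).map β).sum = (l.map β).sum := by
  induction l with
  | nil => rfl
  | cons x l ih =>
    by_cases h : β x = 0
    · simpa [h] using ih
    · simpa [h] using ih

/-- The decision is correct. -/
theorem Inv.mem_sphEq_iff {l : List (UT (ZMod p))} {v : Reg → ZMod p} (h : Inv l v) :
    l ∈ SphEq (UT (ZMod p)) ↔ v .sa = 0 ∧ v .sb = 0 ∧ v .sc = 0 ∧
    ((v .a₀ ≠ 0 ∨ v .c₀ ≠ 0) ∧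
      (v .b₁ ≠ 0 ∨ v .nc ≠ 0 ∨ v .c₀ * v .sd + v .a₀ * v .se = 0) ∨
    (v .a₀ = 0 ∧ v .c₀ = 0) ∧
      (v .b₁ ≠ 0 ∧ (v .nz ≠ 0 ∨ v .b₃ ≠ 0 ∨ v .lhs = v .rhs + v .b₁ * v .sf) ∨
      v .b₁ = 0 ∧ v .sd = 0 ∧ v .se = 0 ∧ (v .nz ≠ 0 ∨ v .sf = 0))) := by
  have hne : ∀ x ∈ l.filter (fun x => b x ≠ 0), b x ≠ 0 := fun x hx => by
    simpa using (List.mem_filter.1 hx).2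
  obtain ⟨q₁, -, q₃⟩ := h.holdsB.ne_nil hne
  have hb₁ : v .b₁ ≠ 0 ↔ ∃ x ∈ l, b x ≠ 0 := by
    rw [q₁, Nat.one_le_iff_ne_zero, ne_eq, List.length_eq_zero_iff]
    simp
  rw [UT4.mem_sphEq_iff, h.sa, h.sb, h.sc]
  refine and_congr_right fun ha => ?_
  by_cases hb : (l.map b).sum = 0
  swap
  · simp only [hb, false_and, iff_false, not_and]
    exact fun _ h0 => hb (fst_of_mem_sum_orbit h0).symm
  rw [and_iff_right hb]
  refine and_congr_right fun hc => ?_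
  by_cases hd : v .a₀ = 0 ∧ v .c₀ = 0
  · have hz := h.dir_zero hd
    have ha0 := fun x hx => (hz x hx).1
    have hc0 := fun x hx => (hz x hx).2
    simp only [hd, ne_eq, not_true_eq_false, or_self, false_and, false_or, and_self, true_and]
    by_cases hB : v .b₁ = 0
    · have hb0 : ∀ x ∈ l, b x = 0 := by
        by_contra! hB'
        exact hb₁.2 hB' hB
      have hf : (l.filter fun x => b x = 0) = l := by
        rw [List.filter_eq_self]
        simpa using hb0
      simp only [hB, not_true_eq_false, false_and, false_or, true_and]
      rw [zero_mem_sum_orbit_iff_of_eq_zero ha0 hc0 hb0, h.sd, h.se, h.sf, hf, ← ne_eq, h.nz]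
      have : (∃ x ∈ l, b x = 0 ∧ (d x ≠ 0 ∨ e x ≠ 0)) ↔ ∃ x ∈ l, d x ≠ 0 ∨ e x ≠ 0 :=
        exists_congr fun x => and_congr_right fun hx => by simp [hb0 x hx]
      rw [this]
    · simp only [hB, not_false_eq_true, true_and, false_and, or_false]
      rw [zero_mem_sum_orbit_iff_of_exists ha0 hc0 (hb₁.1 hB) hb, ← ne_eq, ← ne_eq, h.nz, q₃]
      refine or_congr_right ?_
      rw [← sum_map_filter_ne] at hb
      have hB' := h.holdsB
      have hsf := h.sf
      generalize ((l.filter fun x => b x = 0).map f).sum = Φ at *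
      generalize (l.filter fun x => b x ≠ 0) = m at *
      rcases m with - | ⟨x, - | ⟨y, - | ⟨z, m⟩⟩⟩
      · exact absurd hB'.1 hB
      · simp only [List.map_cons, List.map_nil, List.sum_cons, List.sum_nil, add_zero] at hb
        exact absurd (hB'.1.trans hb) hB
      · obtain ⟨e₁, -, -, e₂, e₃⟩ := hB'
        rw [e₁, e₂, e₃, hsf]
        refine or_congr_right ⟨?_, fun h' => ⟨x, y, rfl, h'⟩⟩
        rintro ⟨_, _, hxy, h'⟩
        simp only [List.cons.injEq, and_true] at hxy
        obtain ⟨rfl, rfl⟩ := hxy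
        exact h'
      · simp
  · have hd' := hd
    rw [not_and_or] at hd'
    obtain ⟨x, hx, h₁, h₂⟩ := h.dir hd'
    rw [zero_mem_sum_orbit_iff_of_ne hx (by rwa [h₁, h₂]) hb, ← hb₁, h₁, h₂, ← h.nc, h.sd, h.se]
    simp [hd, hd']

/-! ### The machine -/

/-- Clear the working stack and reset the control state. -/
def cleanup (c : Control Reg) : Prog Reg :=
  .seq (.loop readWork (fun c => c.w.isSome) skip) (.load fun _ => c)

omit [Fact p.Prime] in
theorem runs_cleanup (c₀ c : Control Reg) {W : List (Column Reg)} (o : List Bool)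
    (hW : W.length ≤ n) :
    (cleanup c₀).Runs n (c, memory [] W [] o) (c₀, memory [] [] [] o) := by
  suffices h : ∃ c' : Control Reg, RelIter (fun s t => ∃ u, readWork.Runs n s u ∧
      u.1.w.isSome = true ∧ (skip : Prog Reg).Runs n u t) W.length
      (c, memory [] W [] o) (c', memory [] [] [] o) by
    obtain ⟨c', h⟩ := h
    exact ⟨_, ⟨W.length, hW, _, h, runs_readWork .., rfl⟩, rfl⟩
  clear hW
  induction W generalizing c with
  | nil => exact ⟨c, rfl⟩
  | cons a W ih =>
    obtain ⟨c', h⟩ := ih { c with w := some a }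
    exact ⟨c', _, ⟨_, runs_readWork .., rfl, rfl⟩, h⟩

/-- The initial control state. -/
def initial : Control Reg := ⟨(false, false), none, none, none⟩

/-- The program that decides the spherical equations over `UT(4, p)`. -/
def main : Prog Reg :=
  .seq readModulus (.seq mainLoop (.seq decideAll (cleanup initial)))

open Classical in
omit [Fact p.Prime] in
/-- The program decides the problem, and no loop is iterated more often than the input is long. -/
theorem runs_main (I : UT4Instance) :
    main.Runs (encodeUT4Instance I).length (initial, memory (encodeUT4Instance I) [] [] [])
      (initial, memory [] [] [] [decide (I ∈ SphEqUT4)]) := by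
  obtain ⟨⟨p, hp⟩, l⟩ := I
  have : Fact p.Prime := ⟨hp⟩
  generalize hn : (encodeUT4Instance ⟨⟨p, hp⟩, l⟩).length = n
  simp only [encodeUT4Instance, encodeNumber, List.length_append, List.length_map,
    List.length_cons, List.length_nil, zero_add] at hn
  have hl : l.length ≤ (l.flatMap encodeUT4).length := by
    clear hn
    induction l with
    | nil => simp
    | cons g l ih =>
      simp only [List.flatMap_cons, List.length_append, List.length_cons, encodeUT4] at ih ⊢
      omega
  obtain ⟨c₁, W₁, hW₁, hH₁, h₁⟩ := runs_readModulus (R := Reg) (p := p) (n := n) initial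
    (l.flatMap encodeUT4) (by omega)
  obtain ⟨v, hv, hI⟩ := exec_mainLoop (n := n) l (by omega)
  obtain ⟨c₂, W₂, hW₂, hH₂, h₂⟩ := hv c₁ W₁ hH₁ hW₁
  obtain ⟨c₃, W₃, hW₃, h₃⟩ := decides_decideAll [] v c₂ W₂ hH₂ (hW₂.trans_le hW₁)
  beta_reduce at h₃
  rw [← hI.mem_sphEq_iff] at h₃
  exact ⟨_, h₁, _, h₂, _, h₃, runs_cleanup _ _ _ hW₃⟩

/-- The machine obtained from the program. -/
noncomputable def machine : FinTM2 :=
  letI : Fintype main.Label := @Fintype.ofFinite _ (finite_label main)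
  { K := Stack
    k₀ := .inp
    k₁ := .out
    Γ := Stack.Alphabet Reg
    Λ := main.Label
    main := main.entry
    σ := Control Reg
    initialState := initial
    Γk₀Fin := inferInstanceAs (Fintype Γ')
    m := main.code id .halt }

end UT4Prog

open UT4Prog in
theorem mainTheorem10 : InP encodingUT4Instance SphEqUT4 := by
  classical
  refine ⟨{ tm := machine, inputAlphabet := Equiv.refl _, outputAlphabet := Equiv.refl _,
            time := main.cost, outputsFun := fun I => ?_ }⟩
  have h := (runs_main I).steps (main.code id .halt) main id .halt fun _ => rfl
  have e₁ : initList machine (encodeUT4Instance I) =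
      ⟨some main.entry, initial, memory (encodeUT4Instance I) [] [] []⟩ := by
    unfold initList
    congr 1
    funext k
    cases k <;> rfl
  have e₂ : haltList machine [decide (I ∈ SphEqUT4)] =
      ⟨none, initial, memory [] [] [] [decide (I ∈ SphEqUT4)]⟩ := by
    unfold haltList
    congr 1
    funext k
    cases k <;> rfl
  have h' : ∃ t ≤ main.cost.eval (encodeUT4Instance I).length,
      (flip bind machine.step)^[t] (some (initList machine (encodeUT4Instance I))) =
        some (haltList machine [decide (I ∈ SphEqUT4)]) := by
    rw [e₁, e₂]
    exact h
  refine ⟨⟨h'.choose, ?_⟩, h'.choose_spec.1⟩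
  have hs := h'.choose_spec.2
  convert hs
  · exact congrArg (initList machine) (List.map_id _)
  · rfl
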